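/- Let $k$ be a field, let $n\ge 1$, and let $\delta,\delta_L,\delta_R,\kappa_L,\kappa_R,\kappa_{LR}\in k$ be arbitrary. Consider $(n,n)$ Temperley--Lieb diagrams (non-crossing pairings, by lines inside a rectangle, of $n$ vertices on the top edge and $n$ vertices on the bottom edge), in which the lines may carry left blobs $L$ and right blobs $R$ in such a way that the lines can be deformed, without crossings, so that simultaneously all left blobs touch the left edge and all right blobs touch the right edge of the rectangle. Let $B_n$ be the set of those diagrams (without loops) in which the word of blobs along a line never contains $LL$, $RR$, $LRL$ or $RLR$, and in which there are not both a line with the two endpoints on the top edge and a line with the two endpoints on the bottom edge that each carry both an $L$ and an $R$. The symplectic blob algebra $b_n=b_n(\delta,\delta_L,\delta_R,\kappa_L,\kappa_R,\kappa_{LR})$ is the $k$-algebra with basis $B_n$ whose product is vertical concatenation of diagrams (the first factor on top), followed by these replacements: * on each loop, consecutive equal blobs are merged, $LL\mapsto\delta_L L$ and $RR\mapsto\delta_R R$, and then the loop is replaced by $\delta$ if it has no blob, by $\kappa_L$ if it has only a left blob, by $\kappa_R$ if it has only a right blob, and by $\kappa_{LR}$ if it has one of each; * on each open line, $LL\mapsto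 \delta_L L$, $RR\mapsto\delta_R R$, $LRL\mapsto\kappa_{LR}L$, $RLR\mapsto \kappa_{LR}R$; * a diagram with a line $\{u,u'\}$ on the top and a line $\{v,v'\}$ on the bottom, both carrying an $L$ (next to $u$, respectively $v$) and an $R$ (next to $u'$, respectively $v'$), is replaced by $\kappa_{LR}$ times the diagram in which these two lines are replaced by the line $\{u,v\}$ carrying $L$ and the line $\{u',v'\}$ carrying $R$. Let $e$ (respectively $f$) be the diagram with $n$ vertical lines whose only blob is an $L$ on the first (respectively an $R$ on the last) line, and for $1\le i\le n-1$ let $e_i$ be the diagram without blobs in which the vertices $i$ and $i+1$ on the top are joined, the vertices $i$ and $i+1$ on the bottom are joined, and all the other lines are vertical. Then $b_n$ is generated, as a unital $k$-algebra, by $e,e_1,\dots,e_{n-1},f$. -/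

import Mathlib

namespace SymplecticBlob

/-- The two decorations: the left blob and the right blob. -/
inductive Blob
  | L
  | R
  deriving DecidableEq

/-- A partition of `V` into pairs ("lines"), each line carrying a word in the free monoid on the
two blobs. `partner v` is the other endpoint of the line at `v`, and `word v` is the word read
along this line from `v` to `partner v`. -/
@[ext]
structure Decorated (V : Type) where
  partner : V → V
  word : V → List Blob
  partner_partner : ∀ v, partner (partner v) = v
  partner_ne : ∀ v, partner v ≠ v
  word_partner : ∀ v, word (partner v) = (word v).reverse

/-- The vertices of an `(n,n)`-diagram: `Sum.inl i` is the `(i+1)`-st vertex on the top edge and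
`Sum.inr i` is the `(i+1)`-st vertex on the bottom edge, both counted from the left. -/
abbrev Vertex (n : ℕ) : Type := Fin n ⊕ Fin n

/-- Decorated pair partitions of the vertices of the rectangle (possibly with crossings). -/
abbrev Diagram (n : ℕ) : Type := Decorated (Vertex n)

/-- Position on the frame, clockwise from the left edge of the rectangle: the top vertices from
left to right have positions `0, …, n-1`, then comes the right edge, then the bottom vertices from
right to left have positions `n, …, 2n-1`, and then comes the left edge again. -/
def pos {n : ℕ} : Vertex n → ℕ
  | Sum.inl i => i
  | Sum.inr i => 2 * n - 1 - i

/-! ### Left-right blob diagrams -/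

section Basis

variable {n : ℕ}

/-- The vertex `v` lies strictly between the endpoints of the line `{u, partner u}`, on the side of
that line that does not contain the left edge (`u` being its endpoint of smaller position). -/
def Diagram.Inside (d : Diagram n) (u v : Vertex n) : Prop :=
  pos u < pos v ∧ pos v < pos (d.partner u)

/-- No two lines cross. -/
def Diagram.Noncrossing (d : Diagram n) : Prop :=
  ∀ u v, d.Inside u v → d.Inside u (d.partner v)

/-- The line at `v` can be deformed to touch the left edge of the frame: no line separates the two.
-/
def Diagram.LExposed (d : Diagram n) (v : Vertex n) : Prop :=
  ∀ u, ¬ d.Inside u v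

/-- The line at `v` can be deformed to touch the right edge of the frame: no other line separates
the two. The right edge lies between the positions `n-1` and `n`. -/
def Diagram.RExposed (d : Diagram n) (v : Vertex n) : Prop :=
  ∀ u, pos u < pos (d.partner u) → u ≠ v → d.partner u ≠ v →
    (d.Inside u v ↔ pos u < n ∧ n ≤ pos (d.partner u))

/-- All the decorated segments can be deformed simultaneously so that the left blobs touch the left
edge and the right blobs touch the right edge. If the first blob met from a vertex is a left
(right) blob, the segment up to it becomes a path from that vertex to the left (right) edge. On
exposed lines, such paths are forced to cross exactly if they start on the same edge of the
rectangle and the one that goes to the right edge starts further to the left. -/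
def Diagram.Simultaneous (d : Diagram n) : Prop :=
  (∀ i j : Fin n, (d.word (Sum.inl i)).head? = some Blob.L →
    (d.word (Sum.inl j)).head? = some Blob.R → i < j) ∧
  (∀ i j : Fin n, (d.word (Sum.inr i)).head? = some Blob.L →
    (d.word (Sum.inr j)).head? = some Blob.R → i < j)

/-- The word contains none of the features `LL`, `RR`, `LRL`, `RLR`. -/
def FeatureFree (w : List Blob) : Prop :=
  ∀ x y : Blob, ¬ [x, x] <:+: w ∧ ¬ [x, y, x] <:+: w

/-- The left-right blob diagrams, the set `B'_n`. (There are no loops, by construction.) -/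
structure Diagram.IsLeftRightBlob (d : Diagram n) : Prop where
  noncrossing : d.Noncrossing
  left_exposed : ∀ v, Blob.L ∈ d.word v → d.LExposed v
  right_exposed : ∀ v, Blob.R ∈ d.word v → d.RExposed v
  simultaneous : d.Simultaneous
  featureFree : ∀ v, FeatureFree (d.word v)

/-- A non-propagating line at the top (one endpoint of which is the vertex `i`) and a
non-propagating line at the bottom (one endpoint of which is the vertex `j`) both carry a left and
a right blob; `i` and `j` are the endpoints next to the left blobs. -/
def Diagram.TopBottomLR (d : Diagram n) (i j : Fin n) : Prop :=
  d.word (Sum.inl i) = [Blob.L, Blob.R] ∧ (d.partner (Sum.inl i)).isLeft = true ∧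
  d.word (Sum.inr j) = [Blob.L, Blob.R] ∧ (d.partner (Sum.inr j)).isRight = true

/-- The basis `B_n` of the symplectic blob algebra. -/
def IsBasisDiagram (d : Diagram n) : Prop :=
  d.IsLeftRightBlob ∧ ∀ i j, ¬ d.TopBottomLR i j

end Basis

/-- The type of basis diagrams, the set `B_n`. -/
abbrev BasisDiagram (n : ℕ) : Type := {d : Diagram n // IsBasisDiagram d}

/-! ### Concatenation -/

section Concatenation

variable {V W : Type}

/-- Two decorated pair partitions side by side. -/
def Decorated.disjointUnion (d : Decorated V) (d' : Decorated W) : Decorated (V ⊕ W) where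
  partner := Sum.map d.partner d'.partner
  word := Sum.elim d.word d'.word
  partner_partner := by
    rintro (v | v) <;> simp [d.partner_partner, d'.partner_partner]
  partner_ne := by
    rintro (v | v) <;> simp [d.partner_ne, d'.partner_ne]
  word_partner := by
    rintro (v | v) <;> simp [d.word_partner, d'.word_partner]

/-- Identify the distinct vertices `a` and `b`. The lines ending there are combined to one line from
`partner a` to `partner b`, and their words are multiplied in the order of the line. (If `a` and `b`
are the two ends of one line, this line becomes a loop and disappears.) The vertices `a` and `b`,
which are now interior, are kept as a dummy undecorated pair. -/
def Decorated.join [DecidableEq V] (d : Decorated V) (a b : V) (hab : a ≠ b) : Decorated V where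
  partner x :=
    if x = a then b
    else if x = b then a
    else if x = d.partner a then d.partner b
    else if x = d.partner b then d.partner a
    else d.partner x
  word x :=
    if x = a then []
    else if x = b then []
    else if x = d.partner a then d.word x ++ d.word b
    else if x = d.partner b then d.word x ++ d.word a
    else d.word x
  partner_partner := by
    intro x
    have := d.partner_partner
    have := d.partner_ne
    grind
  partner_ne := by
    intro x
    have := d.partner_partner
    have := d.partner_ne
    grind
  word_partner := by
    intro x
    have := d.partner_partner
    have := d.partner_ne
    have := d.word_partner
    grind

/-- The parameters `δ, δ_L, δ_R, κ_L, κ_R, κ_LR = k_L = k_R`. -/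
structure Parameters (k : Type*) where
  δ : k
  δL : k
  δR : k
  κL : k
  κR : k
  κLR : k

variable {k : Type*} [Field k] (P : Parameters k)

/-- The scalar by which a loop is replaced. Consecutive equal blobs on the loop are merged, with a
factor `δ_L` or `δ_R` each, and then a loop without blobs gives `δ`, one with a left blob only
`κ_L`, one with a right blob only `κ_R`, and one with both `κ_LR`. (On a loop in a concatenation of
left-right blob diagrams, all the left blobs are consecutive, and so are all the right blobs.) -/
def Parameters.loopValue (w : List Blob) : k :=
  P.δL ^ (w.count Blob.L - 1) * P.δR ^ (w.count Blob.R - 1) *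
    if Blob.L ∈ w then (if Blob.R ∈ w then P.κLR else P.κL)
    else (if Blob.R ∈ w then P.κR else P.δ)

/-- Straightening of the word `x w`, for a word `w` without features: `LL ↦ δ_L L`, `RR ↦ δ_R R`,
`LRL ↦ κ_LR L`, `RLR ↦ κ_LR R`. The result is a scalar and a word. -/
def Parameters.straightenCons : Blob → List Blob → k × List Blob
  | Blob.L, Blob.L :: w => (P.δL, Blob.L :: w)
  | Blob.R, Blob.R :: w => (P.δR, Blob.R :: w)
  | Blob.L, Blob.R :: Blob.L :: w => (P.κLR, Blob.L :: w)
  | Blob.R, Blob.L :: Blob.R :: w => (P.κLR, Blob.R :: w)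
  | x, w => (1, x :: w)

/-- Straightening of the word on an open line: `(c, w')` stands for `c` times the word `w'`. -/
def Parameters.straighten : List Blob → k × List Blob
  | [] => (1, [])
  | x :: w =>
    ((Parameters.straighten w).1 * (P.straightenCons x (Parameters.straighten w).2).1,
      (P.straightenCons x (Parameters.straighten w).2).2)

/-- The straightened word depends only on the first and the last blob. -/
def endBlobs (w : List Blob) : List Blob :=
  match w.head?, w.getLast? with
  | some x, some y => if x = y then [x] else [x, y]
  | _, _ => []

theorem straighten_snd (w : List Blob) : (P.straighten w).2 = endBlobs w := by
  induction w with
  | nil => rfl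
  | cons x w ih =>
    rw [Parameters.straighten, ih]
    rcases w with _ | ⟨y, w⟩
    · cases x <;> rfl
    · obtain ⟨z, hz⟩ : ∃ z, (y :: w).getLast? = some z := ⟨_, List.getLast?_eq_some_getLast (by simp)⟩
      have hz' : (x :: y :: w).getLast? = some z := by
        rw [List.getLast?_cons_cons, hz]
      simp only [endBlobs, hz, hz', List.head?_cons]
      cases x <;> cases y <;> cases z <;> rfl

theorem straighten_reverse (w : List Blob) :
    (P.straighten w.reverse).2 = (P.straighten w).2.reverse := by
  rw [straighten_snd, straighten_snd]
  simp only [endBlobs, List.head?_reverse, List.getLast?_reverse]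
  rcases w.head? with _ | x <;> rcases w.getLast? with _ | y <;> try rfl
  cases x <;> cases y <;> rfl

/-- Straighten the words on all the lines (without the scalars). -/
def Decorated.straightenWords (d : Decorated V) : Decorated V where
  partner := d.partner
  word v := (P.straighten (d.word v)).2
  partner_partner := d.partner_partner
  partner_ne := d.partner_ne
  word_partner v := by rw [d.word_partner, straighten_reverse]

variable {n : ℕ}

/-- The product of the scalars that arise when the words on all the lines are straightened; each
line is read from its endpoint of smaller position. -/
def Diagram.straightenScalar (d : Diagram n) : k :=
  ∏ v with pos v < pos (d.partner v), (P.straighten (d.word v)).1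

/-- The bottom vertex `i` of the upper one of two diagrams. -/
def upperMid (i : Fin n) : Vertex n ⊕ Vertex n := Sum.inl (Sum.inr i)

/-- The top vertex `i` of the lower one of two diagrams. -/
def lowerMid (i : Fin n) : Vertex n ⊕ Vertex n := Sum.inr (Sum.inl i)

/-- The vertices of a concatenation among the vertices of its two factors. -/
def outer : Vertex n → Vertex n ⊕ Vertex n
  | Sum.inl i => Sum.inl (Sum.inl i)
  | Sum.inr i => Sum.inr (Sum.inr i)

theorem upperMid_ne_lowerMid (i j : Fin n) : upperMid i ≠ lowerMid j := by
  simp [upperMid, lowerMid]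

/-- Identify the bottom vertex `i` of the upper diagram with the top vertex `i` of the lower one,
and multiply the scalar by the value of the loop if this closes a loop. -/
def glueStep (s : k × Decorated (Vertex n ⊕ Vertex n)) (i : Fin n) :
    k × Decorated (Vertex n ⊕ Vertex n) :=
  (s.1 * (if s.2.partner (upperMid i) = lowerMid i then P.loopValue (s.2.word (upperMid i)) else 1),
    s.2.join (upperMid i) (lowerMid i) (upperMid_ne_lowerMid i i))

/-- Put `d` on top of `d'` and identify the bottom vertices of `d` with the top vertices of `d'`. -/
def glue (d d' : Diagram n) : k × Decorated (Vertex n ⊕ Vertex n) :=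
  (List.finRange n).foldl (glueStep P) (1, d.disjointUnion d')

theorem foldl_partner (l : List (Fin n)) (s : k × Decorated (Vertex n ⊕ Vertex n)) (i : Fin n)
    (h : i ∈ l ∨ s.2.partner (upperMid i) = lowerMid i) :
    (l.foldl (glueStep P) s).2.partner (upperMid i) = lowerMid i := by
  induction l generalizing s with
  | nil => simpa using h
  | cons j l ih =>
    rw [List.foldl_cons]
    apply ih
    by_cases hij : i = j
    · right
      subst hij
      simp [glueStep, Decorated.join]
    · rcases h with h | h
      · left
        simpa [hij] using h
      · right
        have h1 : upperMid i ≠ upperMid j := by simpa [upperMid] using hij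
        have h2 : lowerMid i ≠ lowerMid j := by simpa [lowerMid] using hij
        have h3 := upperMid_ne_lowerMid i j
        have h4 := upperMid_ne_lowerMid j i
        have := s.2.partner_partner
        simp only [glueStep, Decorated.join]
        grind

theorem glue_partner (d d' : Diagram n) (i : Fin n) :
    (glue P d d').2.partner (upperMid i) = lowerMid i :=
  foldl_partner P _ _ _ (Or.inl (List.mem_finRange i))

theorem exists_outer (d d' : Diagram n) (v : Vertex n) :
    ∃ u, (glue P d d').2.partner (outer v) = outer u := by
  have h := glue_partner P d d'
  have h' := (glue P d d').2.partner_partner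
  rcases hx : (glue P d d').2.partner (outer v) with (i | i) | (i | i)
  · exact ⟨Sum.inl i, rfl⟩
  · exfalso
    have h1 := h' (outer v)
    rw [hx] at h1
    have h2 := (h i).symm.trans h1
    rcases v with v | v <;> simp [outer, lowerMid] at h2
  · exfalso
    have h1 := h' (outer v)
    rw [hx] at h1
    have h2 := h' (upperMid i)
    rw [h i] at h2
    have h3 := h2.symm.trans h1
    rcases v with v | v <;> simp [outer, upperMid] at h3
  · exact ⟨Sum.inr i, rfl⟩

/-- Forget the interior vertices. (No outer vertex is joined to an interior one by `exists_outer`.)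
-/
def outerPart : Vertex n ⊕ Vertex n → Vertex n
  | Sum.inl (Sum.inl i) => Sum.inl i
  | Sum.inr (Sum.inr i) => Sum.inr i
  | Sum.inl (Sum.inr i) => Sum.inr i
  | Sum.inr (Sum.inl i) => Sum.inl i

theorem outerPart_outer (v : Vertex n) : outerPart (outer v) = v := by
  rcases v with v | v <;> rfl

theorem outer_outerPart (d d' : Diagram n) (v : Vertex n) :
    outer (outerPart ((glue P d d').2.partner (outer v))) =
      (glue P d d').2.partner (outer v) := by
  obtain ⟨u, hu⟩ := exists_outer P d d' v
  rw [hu, outerPart_outer]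

/-- The concatenation of `d` (above) and `d'` (below), loops removed, words not yet straightened. -/
def concat (d d' : Diagram n) : Diagram n where
  partner v := outerPart ((glue P d d').2.partner (outer v))
  word v := (glue P d d').2.word (outer v)
  partner_partner v := by
    rw [outer_outerPart, (glue P d d').2.partner_partner, outerPart_outer]
  partner_ne v h := by
    have h1 := congrArg outer h
    rw [outer_outerPart] at h1
    exact (glue P d d').2.partner_ne _ h1
  word_partner v := by
    rw [outer_outerPart, (glue P d d').2.word_partner]

/-- If the lines `{u, u'}` and `{v, v'}` are different, replace them by the lines `{u, v}`, decorated
by a left blob, and `{u', v'}`, decorated by a right blob. -/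
def Decorated.reconnect [DecidableEq V] (d : Decorated V) (u v : V) (h : v ≠ u)
    (h' : v ≠ d.partner u) : Decorated V where
  partner x :=
    if x = u then v
    else if x = v then u
    else if x = d.partner u then d.partner v
    else if x = d.partner v then d.partner u
    else d.partner x
  word x :=
    if x = u ∨ x = v then [Blob.L]
    else if x = d.partner u ∨ x = d.partner v then [Blob.R]
    else d.word x
  partner_partner := by
    intro x
    have := d.partner_partner
    have := d.partner_ne
    grind
  partner_ne := by
    intro x
    have := d.partner_partner
    have := d.partner_ne
    grind
  word_partner := by
    intro x
    have := d.partner_partner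
    have := d.partner_ne
    have := d.word_partner
    grind

theorem Diagram.TopBottomLR.ne_partner {d : Diagram n} {i j : Fin n} (h : d.TopBottomLR i j) :
    Sum.inr j ≠ d.partner (Sum.inl i) := by
  intro h1
  have h2 := h.2.1
  rw [← h1] at h2
  simp at h2

end Concatenation

/-! ### The algebra -/

/-- The symplectic blob algebra `b_n(δ, δ_L, δ_R, κ_L, κ_R, κ_LR)`: the `k`-space with basis `B_n`. -/
def SymplecticBlobAlgebra {k : Type*} [Field k] (_P : Parameters k) (n : ℕ) : Type _ :=
  BasisDiagram n →₀ k

noncomputable section Algebra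

variable {k : Type*} [Field k] (P : Parameters k) {n : ℕ}

instance : AddCommGroup (SymplecticBlobAlgebra P n) :=
  inferInstanceAs (AddCommGroup (BasisDiagram n →₀ k))

instance : Module k (SymplecticBlobAlgebra P n) :=
  inferInstanceAs (Module k (BasisDiagram n →₀ k))

/-- The basis of the algebra by the diagrams in `B_n`. -/
def diagramBasis : Module.Basis (BasisDiagram n) k (SymplecticBlobAlgebra P n) :=
  ⟨LinearEquiv.refl k (BasisDiagram n →₀ k)⟩

open Classical in
/-- A diagram of `B_n` as an element of the algebra. (The value `0` on other diagrams is never used: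
the straightened concatenations of diagrams of `B_n` are again in `B_n`.) -/
def ofDiagram (d : Diagram n) : SymplecticBlobAlgebra P n :=
  if h : IsBasisDiagram d then diagramBasis P ⟨d, h⟩ else 0

open Classical in
/-- The topological relation: a diagram in which a line at the top from `u` to `u'` and a line at the
bottom from `v` to `v'` both carry a left blob followed by a right blob is `κ_LR` times the diagram
in which they are replaced by the propagating lines `{u, v}` with a left blob and `{u', v'}` with a
right blob. Other diagrams are not changed. -/
def topological (d : Diagram n) : SymplecticBlobAlgebra P n :=
  if h : ∃ p : Fin n × Fin n, d.TopBottomLR p.1 p.2 then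
    P.κLR • ofDiagram P (d.reconnect (Sum.inl h.choose.1) (Sum.inr h.choose.2) (by simp)
      h.choose_spec.ne_partner)
  else ofDiagram P d

/-- The product of two basis diagrams: concatenate, replace the loops by scalars, straighten the
words on the lines, and apply the topological relation. -/
def basisMul (d d' : BasisDiagram n) : SymplecticBlobAlgebra P n :=
  ((glue P d.1 d'.1).1 * (concat P d.1 d'.1).straightenScalar P) •
    topological P ((concat P d.1 d'.1).straightenWords P)

/-- The bilinear extension of `basisMul`. -/
def mulMap : SymplecticBlobAlgebra P n →ₗ[k] SymplecticBlobAlgebra P n →ₗ[k]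
    SymplecticBlobAlgebra P n :=
  (diagramBasis P).constr k fun d => (diagramBasis P).constr k fun d' => basisMul P d d'

instance : Mul (SymplecticBlobAlgebra P n) := ⟨fun x y => mulMap P x y⟩

theorem mul_def (x y : SymplecticBlobAlgebra P n) : x * y = mulMap P x y := rfl

theorem basis_mul_basis (d d' : BasisDiagram n) :
    diagramBasis P d * diagramBasis P d' = basisMul P d d' := by
  rw [mul_def, mulMap, Module.Basis.constr_basis, Module.Basis.constr_basis]

/-- The bilinear product. (It is associative with identity `1`, the identity diagram, but neither is
needed to say which subspaces are subalgebras: those that contain `1` and are closed under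
products.) -/
instance : NonUnitalNonAssocRing (SymplecticBlobAlgebra P n) where
  left_distrib x y z := by simp only [mul_def, map_add]
  right_distrib x y z := by simp only [mul_def, map_add, LinearMap.add_apply]
  zero_mul x := by simp only [mul_def, map_zero, LinearMap.zero_apply]
  mul_zero x := by simp only [mul_def, map_zero]

instance : IsScalarTower k (SymplecticBlobAlgebra P n) (SymplecticBlobAlgebra P n) where
  smul_assoc c x y := by simp only [smul_eq_mul, mul_def, map_smul, LinearMap.smul_apply]

instance : SMulCommClass k (SymplecticBlobAlgebra P n) (SymplecticBlobAlgebra P n) where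
  smul_comm c x y := by simp only [smul_eq_mul, mul_def, map_smul]

end Algebra

/-! ### The generators -/

section Generators

variable {n : ℕ}

/-- Vertical lines `{i, i'}`, undecorated except for the word `w` on the line number `m`
(counted from `0`), where `w` has at most one blob. -/
def verticalDiagram (n m : ℕ) (w : List Blob) (hw : w.reverse = w) : Diagram n where
  partner := Sum.swap
  word := Sum.elim (fun i => if i.val = m then w else []) (fun i => if i.val = m then w else [])
  partner_partner := by rintro (i | i) <;> rfl
  partner_ne := by rintro (i | i) <;> simp
  word_partner := by rintro (i | i) <;> simp only [Sum.swap, Sum.elim] <;> split_ifs <;> simp [hw]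

/-- The identity diagram. -/
def identityDiagram (n : ℕ) : Diagram n := verticalDiagram n 0 [] rfl

/-- The diagram `e`: vertical lines, with a left blob on the first one. -/
def eDiagram (n : ℕ) : Diagram n := verticalDiagram n 0 [Blob.L] rfl

/-- The diagram `f`: vertical lines, with a right blob on the last one. -/
def fDiagram (n : ℕ) : Diagram n := verticalDiagram n (n - 1) [Blob.R] rfl

/-- The diagram `e_{i+1}`: undecorated, with lines joining the vertices number `i` and `i + 1`
(counted from `0`) on the top, the same two on the bottom, and vertical lines elsewhere. -/
def cupCapDiagram (n i : ℕ) (hi : i + 1 < n) : Diagram n where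
  partner
    | Sum.inl j => if j.val = i then Sum.inl ⟨i + 1, hi⟩
        else if j.val = i + 1 then Sum.inl ⟨i, Nat.lt_of_succ_lt hi⟩ else Sum.inr j
    | Sum.inr j => if j.val = i then Sum.inr ⟨i + 1, hi⟩
        else if j.val = i + 1 then Sum.inr ⟨i, Nat.lt_of_succ_lt hi⟩ else Sum.inl j
  word _ := []
  partner_partner := by
    rintro (j | j) <;> simp only <;> grind
  partner_ne := by
    rintro (j | j) <;> simp only <;> grind
  word_partner _ := rfl

theorem featureFree_of_length_le_one (w : List Blob) (hw : w.length ≤ 1) : FeatureFree w := by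
  intro x y
  constructor <;> intro h <;> have := h.length_le <;> simp at this <;> omega

theorem verticalDiagram_isBasisDiagram (n m : ℕ) (w : List Blob) (hw : w.reverse = w)
    (hlen : w.length ≤ 1) (hL : Blob.L ∈ w → m = 0) (hR : Blob.R ∈ w → m = n - 1) :
    IsBasisDiagram (verticalDiagram n m w hw) := by
  have hword : ∀ v, (verticalDiagram n m w hw).word v = [] ∨
      (verticalDiagram n m w hw).word v = w := by
    rintro (i | i) <;> simp only [verticalDiagram, Sum.elim] <;> split_ifs <;> simp
  refine ⟨⟨?_, ?_, ?_, ?_, ?_⟩, ?_⟩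
  · rintro (u | u) (v | v) <;>
      simp only [Diagram.Inside, verticalDiagram, Sum.swap_inl, Sum.swap_inr, pos] <;> omega
  · rintro (v | v) hv (u | u) <;> simp only [verticalDiagram, Sum.elim_inl, Sum.elim_inr] at hv <;>
      split_ifs at hv with h <;> try simp at hv
    all_goals
      have := hL hv
      simp only [Diagram.Inside, verticalDiagram, Sum.swap_inl, Sum.swap_inr, pos]
      omega
  · rintro (v | v) hv (u | u) <;> simp only [verticalDiagram, Sum.elim_inl, Sum.elim_inr] at hv <;>
      split_ifs at hv with h <;> try simp at hv
    all_goals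
      have := hR hv
      simp only [Diagram.Inside, verticalDiagram, Sum.swap_inl, Sum.swap_inr, pos, ne_eq,
        Sum.inl.injEq, Sum.inr.injEq, Fin.ext_iff]
      omega
  · have key : ∀ u v, ((verticalDiagram n m w hw).word u).head? = some Blob.L →
        ((verticalDiagram n m w hw).word v).head? = some Blob.R → False := by
      intro u v hu hv
      rcases hword u with h | h <;> rw [h] at hu <;> rcases hword v with h' | h' <;>
        rw [h'] at hv <;> simp_all
    exact ⟨fun i j hi hj => (key _ _ hi hj).elim, fun i j hi hj => (key _ _ hi hj).elim⟩
  · intro v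
    apply featureFree_of_length_le_one
    rcases hword v with h | h <;> rw [h] <;> simp [hlen]
  · intro i j h
    simpa [verticalDiagram] using h.2.1

theorem cupCapDiagram_isBasisDiagram (n i : ℕ) (hi : i + 1 < n) :
    IsBasisDiagram (cupCapDiagram n i hi) := by
  refine ⟨⟨?_, ?_, ?_, ?_, ?_⟩, ?_⟩
  · rintro (u | u) (v | v) <;> simp only [Diagram.Inside, cupCapDiagram] <;> split_ifs <;>
      simp only [pos] <;> omega
  · intro v hv
    simp [cupCapDiagram] at hv
  · intro v hv
    simp [cupCapDiagram] at hv
  · constructor <;> intro a b h <;> simp [cupCapDiagram] at h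
  · intro v
    exact featureFree_of_length_le_one _ (by simp [cupCapDiagram])
  · intro a b h
    simpa [cupCapDiagram] using h.1

end Generators

noncomputable section GeneratingElements

variable {k : Type*} [Field k] (P : Parameters k)

instance (n : ℕ) : One (SymplecticBlobAlgebra P n) :=
  ⟨diagramBasis P ⟨identityDiagram n, verticalDiagram_isBasisDiagram n 0 [] rfl (by simp) (by simp)
    (by simp)⟩⟩

/-- The element `e` of `b_n`. -/
def e (n : ℕ) : SymplecticBlobAlgebra P n :=
  diagramBasis P ⟨eDiagram n, verticalDiagram_isBasisDiagram n 0 [Blob.L] rfl (by simp) (by simp)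
    (by simp)⟩

/-- The element `f` of `b_n`. -/
def f (n : ℕ) : SymplecticBlobAlgebra P n :=
  diagramBasis P ⟨fDiagram n, verticalDiagram_isBasisDiagram n (n - 1) [Blob.R] rfl (by simp) (by simp)
    (by simp)⟩

/-- The element `e_{i+1}` of `b_n`, for `0 ≤ i` and `i + 1 ≤ n - 1`. -/
def cupCap (n i : ℕ) (hi : i + 1 < n) : SymplecticBlobAlgebra P n :=
  diagramBasis P ⟨cupCapDiagram n i hi, cupCapDiagram_isBasisDiagram n i hi⟩

/-- The set `{e, e_1, …, e_{n-1}, f}`. -/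
def generators (n : ℕ) : Set (SymplecticBlobAlgebra P n) :=
  {e P n, f P n} ∪ {x | ∃ (i : ℕ) (hi : i + 1 < n), x = cupCap P n i hi}

end GeneratingElements

end SymplecticBlob

/-!
Suppose that a basis diagram `d` has an undecorated line joining two neighbours `a`, `b` on the top
edge (a cup), and let `s` be `d` with this line moved to `{b, x}` and with the line that ended at
`x` ending at `a` instead. Then `d` is the product of a cup-cap generator and `s`, so it suffices to
generate `s`: cups can be slid across other lines.

The number of blobs is reduced by induction. Up to reflections of the rectangle (the left-right one
exchanges the two kinds of blobs), some top vertex `p` is next to a left blob. If `p` is the first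
vertex, then the blob splits off as a factor `e`. Otherwise either the vertex before `p` is also
next to a left blob, or it is undecorated, and then, as the line at `p` can reach the left edge,
there is a cup to the left of `p`. Sliding this cup across the line at `p` moves the blob to the
left.

In a diagram without blobs that is not the identity there is a cup. It is slid to the right until
it meets the vertical lines at the right edge, and then across the line at the last bottom vertex
that is not on such a line. This gives one more vertical line at the right edge.
-/

namespace SymplecticBlob

section Trace

variable {V : Type}

/-- Follow the line of `D` from `x` to its other end, jump from there along `J`, follow the line of
`D` at which one lands, and so on: `TraceTo D J u x w` says that one arrives at the end `u` of a
line in this way, having read the word `w`. This describes the open lines that are obtained from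
`D` by identifying the vertices related by `J`. -/
inductive TraceTo (D : Decorated V) (J : V → V → Prop) (u : V) : V → List Blob → Prop
  | last {x : V} : D.partner x = u → TraceTo D J u x (D.word x)
  | step {x y : V} {w : List Blob} : J (D.partner x) y → TraceTo D J u y w →
      TraceTo D J u x (D.word x ++ w)

theorem TraceTo.partner_eq_and_word_eq {D : Decorated V} {J : V → V → Prop} {u x : V}
    {w : List Blob} (hJ : ∀ y z, ¬ J y z) (h : TraceTo D J u x w) :
    D.partner x = u ∧ D.word x = w := by
  cases h with
  | last hx => exact ⟨hx, rfl⟩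
  | step hxy _ => exact (hJ _ _ hxy).elim

theorem TraceTo.partner_ne {D : Decorated V} {J : V → V → Prop} {a b u : V} {w : List Blob}
    (hub : u ≠ b) (hJ : ∀ y, J b y → y = a) (h : TraceTo D J u a w) : D.partner a ≠ b := by
  intro hab
  generalize hx : a = x at h
  induction h with
  | last hxu => exact hub (by rw [← hxu, ← hx, hab])
  | step hxy _ ih => exact ih (hJ _ (by rwa [← hab, hx])).symm

section Join

variable [DecidableEq V] {d : Decorated V} {a b y : V} (hab : a ≠ b)

theorem Decorated.join_of_partner_ne (hya : y ≠ a) (hyb : y ≠ b) (ha : d.partner y ≠ a)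
    (hb : d.partner y ≠ b) :
    (d.join a b hab).partner y = d.partner y ∧ (d.join a b hab).word y = d.word y := by
  have := d.partner_partner
  simp only [Decorated.join]
  grind

theorem Decorated.join_of_partner_eq {x : V} (hya : y ≠ a) (hyb : y ≠ b)
    (h : d.partner y = a ∧ x = b ∨ d.partner y = b ∧ x = a) :
    (d.join a b hab).partner y = d.partner x ∧
      (d.join a b hab).word y = d.word y ++ d.word x := by
  have := d.partner_partner
  simp only [Decorated.join]
  grind

variable {J J' : V → V → Prop} {u : V}

/-- The second part strengthens the induction: it concerns the traces that have just jumped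
between `a` and `b`, and which continue the line of the join at `y`. -/
theorem TraceTo.join_and_join_through (hua : u ≠ a) (hub : u ≠ b)
    (hJ : ∀ y z, J y z → (y = a ∧ z = b ∨ y = b ∧ z = a) ∨
      J' y z ∧ (y ≠ a ∧ y ≠ b) ∧ z ≠ a ∧ z ≠ b)
    {x : V} {w : List Blob} (h : TraceTo d J u x w) :
    (x ≠ a → x ≠ b → TraceTo (d.join a b hab) J' u x w) ∧
    ∀ y, y ≠ a → y ≠ b → (d.partner y = a ∧ x = b ∨ d.partner y = b ∧ x = a) →
      TraceTo (d.join a b hab) J' u y (d.word y ++ w) := by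
  induction h with
  | @last x hx =>
    refine ⟨fun hxa hxb => ?_, fun y hya hyb hyx => ?_⟩
    · obtain ⟨hp, hw⟩ := d.join_of_partner_ne hab hxa hxb (hx ▸ hua) (hx ▸ hub)
      exact hw ▸ .last (hp.trans hx)
    · obtain ⟨hp, hw⟩ := d.join_of_partner_eq hab hya hyb hyx
      exact hw ▸ .last (hp.trans hx)
  | @step x z w hxz _ ih =>
    rcases hJ _ _ hxz with hxz' | ⟨hxz', ⟨hpa, hpb⟩, hza, hzb⟩
    · refine ⟨fun hxa hxb => ih.2 x hxa hxb hxz', fun y hya hyb hyx => ?_⟩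
      have := d.partner_partner
      have := d.partner_ne
      grind
    · refine ⟨fun hxa hxb => ?_, fun y hya hyb hyx => ?_⟩
      · obtain ⟨hp, hw⟩ := d.join_of_partner_ne hab hxa hxb hpa hpb
        exact hw ▸ .step (hp ▸ hxz') (ih.1 hza hzb)
      · obtain ⟨hp, hw⟩ := d.join_of_partner_eq hab hya hyb hyx
        rw [← List.append_assoc, ← hw]
        exact .step (hp ▸ hxz') (ih.1 hza hzb)

end Join

end Trace

section Concatenation

variable {n : ℕ}

theorem outer_ne_upperMid (u : Vertex n) (i : Fin n) : outer u ≠ upperMid i := by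
  rcases u with u | u <;> simp [outer, upperMid]

theorem outer_ne_lowerMid (u : Vertex n) (i : Fin n) : outer u ≠ lowerMid i := by
  rcases u with u | u <;> simp [outer, lowerMid]

theorem upperMid_injective : Function.Injective (upperMid (n := n)) := by
  intro i j h
  simpa [upperMid] using h

theorem lowerMid_injective : Function.Injective (lowerMid (n := n)) := by
  intro i j h
  simpa [lowerMid] using h

/-- The identifications made when two diagrams are glued at the positions in `l`: the vertices
`upperMid i` and `lowerMid i` are related to each other, for `i` in `l`. -/
def Glued (l : List (Fin n)) (x y : Vertex n ⊕ Vertex n) : Prop :=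
  ∃ i ∈ l, x = upperMid i ∧ y = lowerMid i ∨ x = lowerMid i ∧ y = upperMid i

theorem Glued.cons_iff {i : Fin n} {l : List (Fin n)} {x y : Vertex n ⊕ Vertex n} :
    Glued (i :: l) x y ↔
      (x = upperMid i ∧ y = lowerMid i ∨ x = lowerMid i ∧ y = upperMid i) ∨ Glued l x y := by
  simp only [Glued, List.exists_mem_cons_iff]

theorem Glued.ne_mid {i : Fin n} {l : List (Fin n)} (hi : i ∉ l) {x y : Vertex n ⊕ Vertex n}
    (h : Glued l x y) :
    (x ≠ upperMid i ∧ x ≠ lowerMid i) ∧ y ≠ upperMid i ∧ y ≠ lowerMid i := by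
  obtain ⟨j, hj, h⟩ := h
  have hji : j ≠ i := fun h => hi (h ▸ hj)
  rcases h with ⟨rfl, rfl⟩ | ⟨rfl, rfl⟩ <;> simp [upperMid, lowerMid, hji]

theorem Glued.eq_upperMid {l : List (Fin n)} {i : Fin n} {y : Vertex n ⊕ Vertex n}
    (h : Glued l (lowerMid i) y) : y = upperMid i := by
  obtain ⟨j, -, ⟨hj, -⟩ | ⟨hj, rfl⟩⟩ := h
  · exact (upperMid_ne_lowerMid j i hj.symm).elim
  · rw [lowerMid_injective hj]

theorem TraceTo.join_mid {D : Decorated (Vertex n ⊕ Vertex n)} {i : Fin n} {l : List (Fin n)}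
    (hi : i ∉ l) {x : Vertex n ⊕ Vertex n} {u : Vertex n} {w : List Blob}
    (hxu : x ≠ upperMid i) (hxl : x ≠ lowerMid i) (h : TraceTo D (Glued (i :: l)) (outer u) x w) :
    TraceTo (D.join (upperMid i) (lowerMid i) (upperMid_ne_lowerMid i i)) (Glued l) (outer u)
      x w := by
  refine (h.join_and_join_through _ (outer_ne_upperMid u i) (outer_ne_lowerMid u i)
    fun y z hyz => ?_).1 hxu hxl
  exact (Glued.cons_iff.1 hyz).imp_right fun h => ⟨h, h.ne_mid hi⟩

variable {k : Type*} [Field k] (P : Parameters k)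

theorem foldl_glueStep_snd {l : List (Fin n)} (hl : l.Nodup)
    (s : k × Decorated (Vertex n ⊕ Vertex n)) {v u : Vertex n} {w : List Blob}
    (h : TraceTo s.2 (Glued l) (outer u) (outer v) w) :
    (l.foldl (glueStep P) s).2.partner (outer v) = outer u ∧
      (l.foldl (glueStep P) s).2.word (outer v) = w := by
  induction l generalizing s with
  | nil => exact h.partner_eq_and_word_eq (by simp [Glued])
  | cons i l ih =>
    rw [List.nodup_cons] at hl
    exact ih hl.2 (glueStep P s i)
      (h.join_mid hl.1 (outer_ne_upperMid v i) (outer_ne_lowerMid v i))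

theorem foldl_glueStep_fst {l : List (Fin n)} (hl : l.Nodup)
    (s : k × Decorated (Vertex n ⊕ Vertex n))
    (h : ∀ i ∈ l, ∃ u w, TraceTo s.2 (Glued l) (outer u) (upperMid i) w) :
    (l.foldl (glueStep P) s).1 = s.1 := by
  induction l generalizing s with
  | nil => rfl
  | cons i l ih =>
    rw [List.nodup_cons] at hl
    have hloop : s.2.partner (upperMid i) ≠ lowerMid i := by
      obtain ⟨u, w, hw⟩ := h i List.mem_cons_self
      exact hw.partner_ne (outer_ne_lowerMid u i) fun y => Glued.eq_upperMid
    have hstep : (glueStep P s i).1 = s.1 := by simp [glueStep, hloop]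
    rw [List.foldl_cons, ih hl.2 (glueStep P s i), hstep]
    intro j hj
    obtain ⟨u, w, hw⟩ := h j (List.mem_cons_of_mem i hj)
    exact ⟨u, w, hw.join_mid hl.1 (fun hji => hl.1 (upperMid_injective hji ▸ hj))
      (upperMid_ne_lowerMid j i)⟩

/-- The traces in the concatenation of `d` (above) and `d'` (below), ending at the vertex `u` of
its frame. -/
abbrev ConcatTrace (d d' : Diagram n) (u : Vertex n) : Vertex n ⊕ Vertex n → List Blob → Prop :=
  TraceTo (d.disjointUnion d') (Glued (List.finRange n)) (outer u)

/-- The concatenation of `d` (above) and `d'` (below) has no loops, because all vertices lie on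
open lines, and it is `r`, even before its words are straightened. -/
structure GluesTo (d d' r : Diagram n) : Prop where
  trace : ∀ v, ConcatTrace d d' (r.partner v) (outer v) (r.word v)
  exists_trace : ∀ x, ∃ u w, ConcatTrace d d' u x w

theorem GluesTo.glue_fst {d d' r : Diagram n} (h : GluesTo d d' r) : (glue P d d').1 = 1 :=
  foldl_glueStep_fst P (List.nodup_finRange n) _ fun _ _ => h.exists_trace _

theorem GluesTo.concat_eq {d d' r : Diagram n} (h : GluesTo d d' r) : concat P d d' = r := by
  have hglue v := foldl_glueStep_snd P (List.nodup_finRange n) (1, d.disjointUnion d') (h.trace v)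
  ext1 <;> funext v
  · exact (congrArg outerPart (hglue v).1).trans (outerPart_outer _)
  · exact (hglue v).2

theorem FeatureFree.eq {w : List Blob} (hw : FeatureFree w) :
    w = [] ∨ w = [Blob.L] ∨ w = [Blob.R] ∨ w = [Blob.L, Blob.R] ∨ w = [Blob.R, Blob.L] := by
  have hxx x w' : w ≠ x :: x :: w' := fun h => (hw x x).1 ⟨[], w', by simp [h]⟩
  have hxyx x y w' : w ≠ x :: y :: x :: w' := fun h => (hw x y).2 ⟨[], w', by simp [h]⟩
  have hxyy x y w' : w ≠ x :: y :: y :: w' := fun h => (hw y y).1 ⟨[x], w', by simp [h]⟩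
  rcases w with _ | ⟨x, _ | ⟨y, _ | ⟨z, w⟩⟩⟩
  · simp
  · cases x <;> simp
  · have := hxx x []
    cases x <;> cases y <;> simp_all
  · have := hxx x (z :: w)
    have := hxyx x y w
    have := hxyy x y w
    cases x <;> cases y <;> cases z <;> simp_all

theorem FeatureFree.straighten {w : List Blob} (hw : FeatureFree w) :
    P.straighten w = (1, w) := by
  rcases hw.eq with rfl | rfl | rfl | rfl | rfl <;>
    simp [Parameters.straighten, Parameters.straightenCons]

theorem topological_of_isBasisDiagram {d : Diagram n} (hd : IsBasisDiagram d) :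
    topological P d = diagramBasis P ⟨d, hd⟩ := by
  have hLR : ¬ ∃ p : Fin n × Fin n, d.TopBottomLR p.1 p.2 := fun ⟨p, hp⟩ => hd.2 p.1 p.2 hp
  rw [topological, dif_neg hLR, ofDiagram, dif_pos hd]

theorem GluesTo.mul_eq {d d' r : BasisDiagram n} (h : GluesTo d.1 d'.1 r.1) :
    diagramBasis P d * diagramBasis P d' = diagramBasis P r := by
  have hword v := (r.2.1.featureFree v).straighten P
  have hscalar : Diagram.straightenScalar P r.1 = 1 :=
    Finset.prod_eq_one fun v _ => by rw [hword]
  have hstraight : Decorated.straightenWords P r.1 = r.1 := by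
    ext1
    · rfl
    · funext v
      simp only [Decorated.straightenWords, hword]
  rw [basis_mul_basis, basisMul, h.glue_fst, h.concat_eq, hscalar, hstraight,
    topological_of_isBasisDiagram P r.2, mul_one, one_smul]

end Concatenation

section Relabel

variable {V W : Type}

/-- Exchange the left and the right blob. -/
def Blob.swap : Blob → Blob
  | Blob.L => Blob.R
  | Blob.R => Blob.L

theorem Blob.swap_swap (x : Blob) : x.swap.swap = x := by
  cases x <;> rfl

theorem map_swap_map_swap (w : List Blob) : (w.map Blob.swap).map Blob.swap = w := by
  rw [List.map_map, show Blob.swap ∘ Blob.swap = id from funext Blob.swap_swap, List.map_id]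

theorem mem_map_swap {w : List Blob} {x : Blob} : x ∈ w.map Blob.swap ↔ x.swap ∈ w := by
  rw [List.mem_map]
  exact ⟨fun ⟨y, hy, hyx⟩ => by rwa [← hyx, Blob.swap_swap], fun h => ⟨_, h, Blob.swap_swap x⟩⟩

theorem head?_map_swap {w : List Blob} {x : Blob} :
    (w.map Blob.swap).head? = some x ↔ w.head? = some x.swap := by
  rcases w with _ | ⟨y, w⟩
  · simp
  · cases x <;> cases y <;> simp [Blob.swap]

theorem FeatureFree.map_swap {w : List Blob} (hw : FeatureFree w) :
    FeatureFree (w.map Blob.swap) := by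
  intro x y
  constructor <;> intro hx <;> have := hx.map Blob.swap <;> rw [map_swap_map_swap] at this
  · exact (hw x.swap y).1 this
  · exact (hw x.swap y.swap).2 this

/-- Rename the vertices by `σ` and the blobs by `β`. -/
def Decorated.relabel (d : Decorated V) (σ : V ≃ W) (β : Blob → Blob) : Decorated W where
  partner w := σ (d.partner (σ.symm w))
  word w := (d.word (σ.symm w)).map β
  partner_partner w := by simp [d.partner_partner]
  partner_ne w h := d.partner_ne (σ.symm w) (by rw [Equiv.eq_symm_apply, h])
  word_partner w := by simp [d.word_partner]

@[simp]
theorem Decorated.relabel_partner (d : Decorated V) (σ : V ≃ W) (β : Blob → Blob) (v : V) :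
    (d.relabel σ β).partner (σ v) = σ (d.partner v) := by
  simp [Decorated.relabel]

@[simp]
theorem Decorated.relabel_word (d : Decorated V) (σ : V ≃ W) (β : Blob → Blob) (v : V) :
    (d.relabel σ β).word (σ v) = (d.word v).map β := by
  simp [Decorated.relabel]

theorem TraceTo.relabel {D : Decorated V} {J : V → V → Prop} {J' : W → W → Prop} (σ : V ≃ W)
    (β : Blob → Blob) (hJ : ∀ x y, J x y → J' (σ x) (σ y)) {u x : V} {w : List Blob}
    (h : TraceTo D J u x w) : TraceTo (D.relabel σ β) J' (σ u) (σ x) (w.map β) := by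
  induction h with
  | last hx =>
    rw [← D.relabel_word σ]
    exact .last (by rw [Decorated.relabel_partner, hx])
  | step hxy _ ih =>
    rw [List.map_append, ← D.relabel_word σ]
    exact .step (by rw [Decorated.relabel_partner]; exact hJ _ _ hxy) ih

end Relabel

section Symmetry

variable {n : ℕ}

/-- Exchange the top edge and the bottom edge. -/
def Diagram.flip (d : Diagram n) : Diagram n := d.relabel (Equiv.sumComm _ _) id

/-- The reflection of the vertices that exchanges the left edge and the right edge. -/
def mirrorVertex : Vertex n ≃ Vertex n := Equiv.sumCongr Fin.revPerm Fin.revPerm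

/-- Exchange the left edge and the right edge, and the left and the right blobs. -/
def Diagram.mirror (d : Diagram n) : Diagram n := d.relabel mirrorVertex Blob.swap

theorem Diagram.flip_partner (d : Diagram n) (v : Vertex n) :
    d.flip.partner v.swap = (d.partner v).swap :=
  d.relabel_partner (Equiv.sumComm _ _) id v

theorem Diagram.flip_word (d : Diagram n) (v : Vertex n) : d.flip.word v.swap = d.word v :=
  (d.relabel_word (Equiv.sumComm _ _) id v).trans (List.map_id _)

theorem Diagram.mirror_partner (d : Diagram n) (v : Vertex n) :
    d.mirror.partner (mirrorVertex v) = mirrorVertex (d.partner v) :=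
  d.relabel_partner _ _ v

theorem Diagram.mirror_word (d : Diagram n) (v : Vertex n) :
    d.mirror.word (mirrorVertex v) = (d.word v).map Blob.swap :=
  d.relabel_word _ _ v

theorem Diagram.flip_flip (d : Diagram n) : d.flip.flip = d := by
  ext1 <;> funext v <;> simp [Diagram.flip, Decorated.relabel]

theorem mirrorVertex_mirrorVertex (v : Vertex n) : mirrorVertex (mirrorVertex v) = v := by
  rcases v with v | v <;> simp [mirrorVertex]

theorem Diagram.mirror_mirror (d : Diagram n) : d.mirror.mirror = d := by
  ext1 <;> funext v <;> rw [← mirrorVertex_mirrorVertex v]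
  · rw [mirror_partner, mirror_partner, mirrorVertex_mirrorVertex, mirrorVertex_mirrorVertex]
  · rw [mirror_word, mirror_word, map_swap_map_swap, mirrorVertex_mirrorVertex]

theorem forall_swap {p : Vertex n → Prop} : (∀ v, p v) ↔ ∀ v : Vertex n, p v.swap :=
  (Equiv.sumComm _ _).forall_congr_right.symm

theorem mirrorVertex_inl (i : Fin n) : mirrorVertex (Sum.inl i) = Sum.inl i.rev := rfl

theorem mirrorVertex_inr (i : Fin n) : mirrorVertex (Sum.inr i) = Sum.inr i.rev := rfl

theorem pos_lt (v : Vertex n) : pos v < 2 * n := by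
  rcases v with v | v <;> simp only [pos] <;> omega

theorem pos_injective : Function.Injective (pos (n := n)) := by
  rintro (u | u) (v | v) h <;> simp only [pos] at h <;>
    simp only [Sum.inl.injEq, Sum.inr.injEq, reduceCtorEq, Fin.ext_iff] <;> omega

theorem pos_swap (v : Vertex n) : pos v.swap + pos v + 1 = 2 * n := by
  rcases v with v | v <;> simp only [pos, Sum.swap_inl, Sum.swap_inr] <;> omega

theorem pos_mirrorVertex (v : Vertex n) :
    pos v < n ∧ pos (mirrorVertex v) + pos v + 1 = n ∨
    n ≤ pos v ∧ pos (mirrorVertex v) + pos v + 1 = 3 * n := by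
  rcases v with v | v <;>
    simp only [pos, mirrorVertex_inl, mirrorVertex_inr, Fin.val_rev] <;> omega

variable {d : Diagram n}

theorem Diagram.noncrossing_iff :
    d.Noncrossing ↔ ∀ u v, ¬ (pos u < pos v ∧ pos v < pos (d.partner u) ∧
      pos (d.partner u) < pos (d.partner v)) := by
  refine ⟨fun h u v huv => ?_, fun h u v huv => ?_⟩
  · have := (h u v ⟨huv.1, huv.2.1⟩).2
    omega
  · have hv := h u v
    have hpv := h (d.partner v) u
    simp only [Diagram.Inside, d.partner_partner] at *
    have hvu : pos (d.partner v) ≠ pos u := fun h => by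
      have := congrArg d.partner (pos_injective h)
      rw [d.partner_partner] at this
      rw [this] at huv
      omega
    have hvpu : pos (d.partner v) ≠ pos (d.partner u) := fun h => by
      have := congrArg d.partner (pos_injective h)
      rw [d.partner_partner, d.partner_partner] at this
      rw [this] at huv
      omega
    omega

theorem Diagram.Noncrossing.flip (hd : d.Noncrossing) : d.flip.Noncrossing := by
  rw [noncrossing_iff] at *
  refine forall_swap.2 fun u => forall_swap.2 fun v => ?_
  have hvu := hd (d.partner v) (d.partner u)
  simp only [flip_partner, d.partner_partner] at *
  have := pos_swap u
  have := pos_swap v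
  have := pos_swap (d.partner u)
  have := pos_swap (d.partner v)
  omega

theorem Diagram.Noncrossing.mirror (hd : d.Noncrossing) : d.mirror.Noncrossing := by
  rw [noncrossing_iff] at *
  refine mirrorVertex.forall_congr_right.1 fun u => mirrorVertex.forall_congr_right.1 fun v => ?_
  -- The reflection reverses the cyclic order, so that each of the four endpoints can come first.
  have h₁ := hd (d.partner v) (d.partner u)
  have h₂ := hd (d.partner u) v
  have h₃ := hd v u
  have h₄ := hd u (d.partner v)
  simp only [mirror_partner, d.partner_partner] at *
  have := pos_lt u
  have := pos_lt v
  have := pos_lt (d.partner u)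
  have := pos_lt (d.partner v)
  have := pos_mirrorVertex u
  have := pos_mirrorVertex v
  have := pos_mirrorVertex (d.partner u)
  have := pos_mirrorVertex (d.partner v)
  omega

theorem Diagram.LExposed.flip {v : Vertex n} (hv : d.LExposed v) : d.flip.LExposed v.swap := by
  refine forall_swap.2 fun u => ?_
  have := hv (d.partner u)
  simp only [Inside, flip_partner, d.partner_partner] at *
  have := pos_swap u
  have := pos_swap v
  have := pos_swap (d.partner u)
  omega

theorem Diagram.RExposed.flip {v : Vertex n} (hv : d.RExposed v) : d.flip.RExposed v.swap := by
  refine forall_swap.2 fun u hu huv hpuv => ?_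
  have hpu := hv (d.partner u)
  simp only [Inside, flip_partner, d.partner_partner] at *
  have := pos_swap u
  have := pos_swap v
  have := pos_swap (d.partner u)
  have := hpu (by omega) (fun h => hpuv (h ▸ rfl)) (fun h => huv (h ▸ rfl))
  omega

theorem Diagram.LExposed.mirror {v : Vertex n} (hv : d.LExposed v) :
    d.mirror.RExposed (mirrorVertex v) := by
  refine mirrorVertex.forall_congr_right.1 fun u hu huv hpuv => ?_
  have hvu := hv u
  have hvpu := hv (d.partner u)
  simp only [Inside, mirror_partner, d.partner_partner, mirrorVertex.injective.ne_iff] at *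
  have := pos_injective.ne huv
  have := pos_injective.ne hpuv
  have := pos_lt u
  have := pos_lt v
  have := pos_lt (d.partner u)
  have := pos_mirrorVertex u
  have := pos_mirrorVertex v
  have := pos_mirrorVertex (d.partner u)
  omega

theorem Diagram.RExposed.mirror {v : Vertex n} (hv : d.RExposed v) :
    d.mirror.LExposed (mirrorVertex v) := by
  refine mirrorVertex.forall_congr_right.1 fun u => ?_
  have hvu := hv u
  have hvpu := hv (d.partner u)
  rw [d.partner_partner] at hvpu
  simp only [Inside, mirror_partner, d.partner_partner] at *
  rcases eq_or_ne u v with rfl | huv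
  · omega
  rcases eq_or_ne (d.partner u) v with rfl | hpuv
  · omega
  have := pos_injective.ne huv
  have := pos_injective.ne hpuv
  have := pos_injective.ne (d.partner_ne u)
  have := pos_lt u
  have := pos_lt v
  have := pos_lt (d.partner u)
  have := pos_mirrorVertex u
  have := pos_mirrorVertex v
  have := pos_mirrorVertex (d.partner u)
  have : pos u < pos (d.partner u) ∨ pos (d.partner u) < pos u := by omega
  rcases this with h | h
  · have := hvu h huv hpuv
    omega
  · have := hvpu h hpuv huv
    omega

theorem IsBasisDiagram.flip (hd : IsBasisDiagram d) : IsBasisDiagram d.flip := by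
  obtain ⟨hd, hLR⟩ := hd
  refine ⟨⟨hd.noncrossing.flip, ?_, ?_, ⟨fun i j hi hj => ?_, fun i j hi hj => ?_⟩, ?_⟩, ?_⟩
  · refine forall_swap.2 fun v hv => (hd.left_exposed v ?_).flip
    rwa [d.flip_word] at hv
  · refine forall_swap.2 fun v hv => (hd.right_exposed v ?_).flip
    rwa [d.flip_word] at hv
  · exact hd.simultaneous.2 i j (by rwa [← d.flip_word]) (by rwa [← d.flip_word])
  · exact hd.simultaneous.1 i j (by rwa [← d.flip_word]) (by rwa [← d.flip_word])
  · refine forall_swap.2 fun v => ?_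
    rw [d.flip_word]
    exact hd.featureFree v
  · rintro i j ⟨hi, hpi, hj, hpj⟩
    refine hLR j i ⟨by rwa [← d.flip_word], ?_, by rwa [← d.flip_word], ?_⟩
    · simpa using (congrArg Sum.isRight (d.flip_partner (Sum.inl j))).symm.trans hpj
    · simpa using (congrArg Sum.isLeft (d.flip_partner (Sum.inr i))).symm.trans hpi

theorem Diagram.head?_mirror_word {v : Vertex n} {x : Blob} :
    (d.mirror.word (mirrorVertex v)).head? = some x ↔ (d.word v).head? = some x.swap := by
  rw [mirror_word, head?_map_swap]

theorem Diagram.Simultaneous.mirror (hd : d.Simultaneous) : d.mirror.Simultaneous := by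
  refine ⟨?_, ?_⟩ <;> refine Fin.revPerm.forall_congr_right.1 fun i =>
    Fin.revPerm.forall_congr_right.1 fun j hi hj => Fin.rev_lt_rev.2 ?_
  · exact hd.1 j i (head?_mirror_word (v := Sum.inl j).1 hj)
      (head?_mirror_word (v := Sum.inl i).1 hi)
  · exact hd.2 j i (head?_mirror_word (v := Sum.inr j).1 hj)
      (head?_mirror_word (v := Sum.inr i).1 hi)

theorem Diagram.word_partner_eq_of_mirror_word_eq {v : Vertex n}
    (h : d.mirror.word (mirrorVertex v) = [Blob.L, Blob.R]) :
    d.word (d.partner v) = [Blob.L, Blob.R] := by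
  rw [d.word_partner, ← map_swap_map_swap (d.word v), ← mirror_word, h]
  rfl

theorem Diagram.TopBottomLR.of_mirror {i j : Fin n} (h : d.mirror.TopBottomLR i j) :
    ∃ i' j', d.TopBottomLR i' j' := by
  obtain ⟨hi, hpi, hj, hpj⟩ := h
  rw [← i.rev_rev, ← mirrorVertex_inl] at hi hpi
  rw [← j.rev_rev, ← mirrorVertex_inr] at hj hpj
  rw [mirror_partner] at hpi hpj
  have hi := word_partner_eq_of_mirror_word_eq hi
  have hj := word_partner_eq_of_mirror_word_eq hj
  rcases hi' : d.partner (Sum.inl i.rev) with i' | i' <;> rw [hi'] at hi hpi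
  · rcases hj' : d.partner (Sum.inr j.rev) with j' | j' <;> rw [hj'] at hj hpj
    · simp [mirrorVertex_inl] at hpj
    · exact ⟨i', j', hi, by simp [← hi', d.partner_partner], hj,
        by simp [← hj', d.partner_partner]⟩
  · simp [mirrorVertex_inr] at hpi

theorem IsBasisDiagram.mirror (hd : IsBasisDiagram d) : IsBasisDiagram d.mirror := by
  obtain ⟨hd, hLR⟩ := hd
  refine ⟨⟨hd.noncrossing.mirror, ?_, ?_, hd.simultaneous.mirror, ?_⟩, fun i j hij => ?_⟩
  · refine mirrorVertex.forall_congr_right.1 fun v hv => (hd.right_exposed v ?_).mirror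
    rwa [d.mirror_word, mem_map_swap] at hv
  · refine mirrorVertex.forall_congr_right.1 fun v hv => (hd.left_exposed v ?_).mirror
    rwa [d.mirror_word, mem_map_swap] at hv
  · refine mirrorVertex.forall_congr_right.1 fun v => ?_
    rw [d.mirror_word]
    exact (hd.featureFree v).map_swap
  · obtain ⟨i', j', h⟩ := hij.of_mirror
    exact hLR i' j' h

/-- The action of `Diagram.flip` on the vertices of two diagrams, one above the other. -/
def flipBoth : Vertex n ⊕ Vertex n ≃ Vertex n ⊕ Vertex n :=
  (Equiv.sumComm _ _).trans (Equiv.sumCongr (Equiv.sumComm _ _) (Equiv.sumComm _ _))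

/-- The action of `Diagram.mirror` on the vertices of two diagrams, one above the other. -/
def mirrorBoth : Vertex n ⊕ Vertex n ≃ Vertex n ⊕ Vertex n :=
  Equiv.sumCongr mirrorVertex mirrorVertex

theorem disjointUnion_flip (d d' : Diagram n) :
    d'.flip.disjointUnion d.flip = (d.disjointUnion d').relabel flipBoth id := by
  ext1 <;> funext x <;> rcases x with x | x <;>
    simp [Decorated.disjointUnion, Decorated.relabel, flipBoth, Diagram.flip]

theorem disjointUnion_mirror (d d' : Diagram n) :
    d.mirror.disjointUnion d'.mirror = (d.disjointUnion d').relabel mirrorBoth Blob.swap := by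
  ext1 <;> funext x <;> rcases x with x | x <;>
    simp [Decorated.disjointUnion, Decorated.relabel, mirrorBoth, Diagram.mirror]

theorem flipBoth_outer (v : Vertex n) : flipBoth (outer v) = outer v.swap := by
  rcases v with v | v <;> rfl

theorem mirrorBoth_outer (v : Vertex n) : mirrorBoth (outer v) = outer (mirrorVertex v) := by
  rcases v with v | v <;> rfl

theorem ConcatTrace.flip {d d' : Diagram n} {x : Vertex n ⊕ Vertex n} {u : Vertex n}
    {w : List Blob} (h : ConcatTrace d d' u x w) :
    ConcatTrace d'.flip d.flip u.swap (flipBoth x) w := by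
  rw [ConcatTrace, disjointUnion_flip, ← flipBoth_outer, ← w.map_id]
  refine TraceTo.relabel _ _ ?_ h
  rintro _ _ ⟨i, hi, ⟨rfl, rfl⟩ | ⟨rfl, rfl⟩⟩
  · exact ⟨i, hi, Or.inr ⟨rfl, rfl⟩⟩
  · exact ⟨i, hi, Or.inl ⟨rfl, rfl⟩⟩

theorem ConcatTrace.mirror {d d' : Diagram n} {x : Vertex n ⊕ Vertex n} {u : Vertex n}
    {w : List Blob} (h : ConcatTrace d d' u x w) :
    ConcatTrace d.mirror d'.mirror (mirrorVertex u) (mirrorBoth x) (w.map Blob.swap) := by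
  rw [ConcatTrace, disjointUnion_mirror, ← mirrorBoth_outer]
  refine TraceTo.relabel _ _ ?_ h
  rintro _ _ ⟨i, -, ⟨rfl, rfl⟩ | ⟨rfl, rfl⟩⟩
  · exact ⟨i.rev, List.mem_finRange _, Or.inl ⟨rfl, rfl⟩⟩
  · exact ⟨i.rev, List.mem_finRange _, Or.inr ⟨rfl, rfl⟩⟩

variable {d' r : Diagram n}

theorem GluesTo.flip (h : GluesTo d d' r) : GluesTo d'.flip d.flip r.flip := by
  refine ⟨forall_swap.2 fun v => ?_, flipBoth.forall_congr_right.1 fun x => ?_⟩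
  · rw [r.flip_partner, r.flip_word, ← flipBoth_outer]
    exact (h.trace v).flip
  · obtain ⟨u, w, hx⟩ := h.exists_trace x
    exact ⟨_, _, hx.flip⟩

theorem GluesTo.mirror (h : GluesTo d d' r) : GluesTo d.mirror d'.mirror r.mirror := by
  refine ⟨mirrorVertex.forall_congr_right.1 fun v => ?_,
    mirrorBoth.forall_congr_right.1 fun x => ?_⟩
  · rw [r.mirror_partner, r.mirror_word, ← mirrorBoth_outer]
    exact (h.trace v).mirror
  · obtain ⟨u, w, hx⟩ := h.exists_trace x
    exact ⟨_, _, hx.mirror⟩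

end Symmetry

section Generators

variable {n : ℕ}

theorem flip_verticalDiagram (m : ℕ) (w : List Blob) (hw : w.reverse = w) :
    (verticalDiagram n m w hw).flip = verticalDiagram n m w hw := by
  ext1 <;> funext v <;> rcases v with v | v <;>
    simp [Diagram.flip, Decorated.relabel, verticalDiagram]

theorem flip_identityDiagram : (identityDiagram n).flip = identityDiagram n :=
  flip_verticalDiagram 0 [] rfl

theorem mirror_verticalDiagram_partner (m : ℕ) (w : List Blob) (hw : w.reverse = w) :
    (verticalDiagram n m w hw).mirror.partner = Sum.swap :=
  funext (mirrorVertex.forall_congr_right.1 fun v => by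
    rw [Diagram.mirror_partner]
    rcases v with v | v <;> rfl)

theorem mirror_identityDiagram : (identityDiagram n).mirror = identityDiagram n := by
  ext1
  · exact mirror_verticalDiagram_partner _ _ _
  · funext v
    rcases v with v | v <;>
      simp [Diagram.mirror, Decorated.relabel, identityDiagram, verticalDiagram]

theorem mirror_eDiagram : (eDiagram n).mirror = fDiagram n := by
  have hrev (i : Fin n) : i.rev.val = n - 1 ↔ i.val = 0 := by
    rw [Fin.val_rev]
    omega
  ext1
  · exact mirror_verticalDiagram_partner _ _ _
  · refine funext (mirrorVertex.forall_congr_right.1 fun v => ?_)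
    rw [Diagram.mirror_word]
    rcases v with v | v <;>
      simp only [eDiagram, fDiagram, verticalDiagram, mirrorVertex_inl, mirrorVertex_inr,
        Sum.elim_inl, Sum.elim_inr, hrev, apply_ite (List.map Blob.swap), List.map_nil] <;> rfl

theorem flip_cupCapDiagram (i : ℕ) (hi : i + 1 < n) :
    (cupCapDiagram n i hi).flip = cupCapDiagram n i hi := by
  ext1
  · refine funext (forall_swap.2 fun v => ?_)
    rw [Diagram.flip_partner]
    rcases v with v | v <;> simp only [cupCapDiagram, Sum.swap_inl, Sum.swap_inr] <;>
      split_ifs <;> rfl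
  · rfl

theorem mirror_cupCapDiagram (i : ℕ) (hi : i + 1 < n) :
    (cupCapDiagram n i hi).mirror = cupCapDiagram n (n - 2 - i) (by omega) := by
  ext1
  · refine funext (mirrorVertex.forall_congr_right.1 fun v => ?_)
    rw [Diagram.mirror_partner]
    rcases v with v | v <;> simp only [cupCapDiagram, mirrorVertex_inl, mirrorVertex_inr,
      Fin.val_rev] <;> split_ifs <;>
      simp only [mirrorVertex_inl, mirrorVertex_inr, Sum.inl.injEq, Sum.inr.injEq, Fin.ext_iff,
        Fin.val_rev] <;> omega
  · rfl

/-- The diagrams `e`, `f` and `e_1, …, e_{n-1}`. -/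
def IsGenerator (g : Diagram n) : Prop :=
  g = eDiagram n ∨ g = fDiagram n ∨ ∃ i hi, g = cupCapDiagram n i hi

theorem IsGenerator.flip {g : Diagram n} (hg : IsGenerator g) : IsGenerator g.flip := by
  rcases hg with rfl | rfl | ⟨i, hi, rfl⟩
  · exact Or.inl (flip_verticalDiagram _ _ _)
  · exact Or.inr (Or.inl (flip_verticalDiagram _ _ _))
  · exact Or.inr (Or.inr ⟨i, hi, flip_cupCapDiagram i hi⟩)

theorem IsGenerator.mirror {g : Diagram n} (hg : IsGenerator g) : IsGenerator g.mirror := by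
  rcases hg with rfl | rfl | ⟨i, hi, rfl⟩
  · exact Or.inr (Or.inl mirror_eDiagram)
  · exact Or.inl (by rw [← mirror_eDiagram, Diagram.mirror_mirror])
  · exact Or.inr (Or.inr ⟨_, _, mirror_cupCapDiagram i hi⟩)

/-- The diagrams of `B_n` that are obtained from the identity diagram by multiplying by generators
on either side, where no product involves a loop or a relation. -/
inductive Generated : Diagram n → Prop
  | one : Generated (identityDiagram n)
  | mul_left {g d r : Diagram n} : IsGenerator g → Generated d → IsBasisDiagram r →
      GluesTo g d r → Generated r
  | mul_right {g d r : Diagram n} : IsGenerator g → Generated d → IsBasisDiagram r →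
      GluesTo d g r → Generated r

theorem Generated.flip {d : Diagram n} (hd : Generated d) : Generated d.flip := by
  induction hd with
  | one =>
    rw [flip_identityDiagram]
    exact .one
  | mul_left hg _ hr h ih => exact .mul_right hg.flip ih hr.flip h.flip
  | mul_right hg _ hr h ih => exact .mul_left hg.flip ih hr.flip h.flip

theorem Generated.mirror {d : Diagram n} (hd : Generated d) : Generated d.mirror := by
  induction hd with
  | one =>
    rw [mirror_identityDiagram]
    exact .one
  | mul_left hg _ hr h ih => exact .mul_left hg.mirror ih hr.mirror h.mirror
  | mul_right hg _ hr h ih => exact .mul_right hg.mirror ih hr.mirror h.mirror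

theorem isBasisDiagram_identityDiagram : IsBasisDiagram (identityDiagram n) :=
  verticalDiagram_isBasisDiagram n 0 [] rfl (by simp) (by simp) (by simp)

theorem Generated.isBasisDiagram {d : Diagram n} (hd : Generated d) : IsBasisDiagram d := by
  cases hd with
  | one => exact isBasisDiagram_identityDiagram
  | mul_left _ _ hd _ => exact hd
  | mul_right _ _ hd _ => exact hd

variable {k : Type*} [Field k] (P : Parameters k)

theorem IsGenerator.exists_mem_generators {g : Diagram n} (hg : IsGenerator g) :
    ∃ h, diagramBasis P ⟨g, h⟩ ∈ generators P n := by
  rcases hg with rfl | rfl | ⟨i, hi, rfl⟩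
  · exact ⟨_, Or.inl (Or.inl rfl)⟩
  · exact ⟨_, Or.inl (Or.inr rfl)⟩
  · exact ⟨_, Or.inr ⟨i, hi, rfl⟩⟩

theorem Generated.diagramBasis_mem_adjoin {d : Diagram n} (hd : Generated d) :
    diagramBasis P ⟨d, hd.isBasisDiagram⟩ ∈
      NonUnitalAlgebra.adjoin k (insert 1 (generators P n)) := by
  have hgen {g : Diagram n} (hg : IsGenerator g) :
      ∃ h, diagramBasis P ⟨g, h⟩ ∈ NonUnitalAlgebra.adjoin k (insert 1 (generators P n)) :=
    (hg.exists_mem_generators P).imp fun _ h =>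
      NonUnitalAlgebra.subset_adjoin k (Set.mem_insert_of_mem 1 h)
  induction hd with
  | one => exact NonUnitalAlgebra.subset_adjoin k (Set.mem_insert 1 _)
  | mul_left hg hd hr h ih =>
    obtain ⟨hb, hg⟩ := hgen hg
    rw [← GluesTo.mul_eq P (d := ⟨_, hb⟩) (d' := ⟨_, hd.isBasisDiagram⟩) h]
    exact mul_mem hg ih
  | mul_right hg hd hr h ih =>
    obtain ⟨hb, hg⟩ := hgen hg
    rw [← GluesTo.mul_eq P (d := ⟨_, hd.isBasisDiagram⟩) (d' := ⟨_, hb⟩) h]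
    exact mul_mem ih hg

end Generators

section Products

variable {n : ℕ} {d d' : Diagram n} {u : Vertex n} {v : Vertex n} {i j : Fin n} {w : List Blob}

theorem ConcatTrace.start_propagating (h : d.partner (Sum.inl i) = Sum.inr j)
    (ht : ConcatTrace d d' u (Sum.inr (Sum.inl j)) w) :
    ConcatTrace d d' u (outer (Sum.inl i)) (d.word (Sum.inl i) ++ w) :=
  .step (D := d.disjointUnion d') (x := outer (Sum.inl i)) (y := lowerMid j)
    ⟨j, List.mem_finRange j, Or.inl ⟨congrArg Sum.inl h, rfl⟩⟩ ht

theorem ConcatTrace.start_top (h : d.partner (Sum.inl i) = Sum.inl j) :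
    ConcatTrace d d' (Sum.inl j) (outer (Sum.inl i)) (d.word (Sum.inl i)) :=
  .last (D := d.disjointUnion d') (x := outer (Sum.inl i)) (congrArg Sum.inl h)

theorem ConcatTrace.arrive_bottom (h : d'.partner v = Sum.inr j) :
    ConcatTrace d d' (Sum.inr j) (Sum.inr v) (d'.word v) :=
  .last (D := d.disjointUnion d') (x := Sum.inr v) (congrArg Sum.inr h)

theorem ConcatTrace.arrive_top (h : d'.partner v = Sum.inl i)
    (hi : d.partner (Sum.inr i) = Sum.inl j) :
    ConcatTrace d d' (Sum.inl j) (Sum.inr v) (d'.word v ++ d.word (Sum.inr i)) :=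
  .step (D := d.disjointUnion d') (x := Sum.inr v) (y := upperMid i)
    ⟨i, List.mem_finRange i, Or.inr ⟨congrArg Sum.inr h, rfl⟩⟩
    (.last (D := d.disjointUnion d') (x := upperMid i) (congrArg Sum.inl hi))

theorem ConcatTrace.turn (h : d'.partner v = Sum.inl i) (hi : d.partner (Sum.inr i) = Sum.inr j)
    (ht : ConcatTrace d d' u (Sum.inr (Sum.inl j)) w) :
    ConcatTrace d d' u (Sum.inr v) (d'.word v ++ (d.word (Sum.inr i) ++ w)) :=
  .step (D := d.disjointUnion d') (x := Sum.inr v) (y := upperMid i)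
    ⟨i, List.mem_finRange i, Or.inr ⟨congrArg Sum.inr h, rfl⟩⟩
    (.step (D := d.disjointUnion d') (x := upperMid i) (y := lowerMid j)
      ⟨j, List.mem_finRange j, Or.inl ⟨congrArg Sum.inl hi, rfl⟩⟩ ht)

theorem exists_concatTrace_of_lower (h : ∀ v, ∃ u w, ConcatTrace d d' u (Sum.inr v) w)
    (x : Vertex n ⊕ Vertex n) : ∃ u w, ConcatTrace d d' u x w := by
  rcases x with v | v
  · rcases hv : d.partner v with i | i
    · exact ⟨Sum.inl i, _, .last (congrArg Sum.inl hv)⟩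
    · obtain ⟨u, w, ht⟩ := h (Sum.inl i)
      exact ⟨u, _, .step (y := lowerMid i)
        ⟨i, List.mem_finRange i, Or.inl ⟨congrArg Sum.inl hv, rfl⟩⟩ ht⟩
  · exact h v

theorem inl_ne_inl_of_val_eq_succ {a b : Fin n} (hab : b.val = a.val + 1) :
    (Sum.inl a : Vertex n) ≠ Sum.inl b := by
  simp [Fin.ext_iff, hab]

section CupCap

variable {a b : Fin n} (hab : b.val = a.val + 1)

theorem cupCapDiagram_partner_of_ne (ha : j ≠ a) (hb : j ≠ b) :
    (cupCapDiagram n a (hab ▸ b.isLt)).partner (Sum.inl j) = Sum.inr j ∧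
      (cupCapDiagram n a (hab ▸ b.isLt)).partner (Sum.inr j) = Sum.inl j := by
  rw [ne_eq, Fin.ext_iff] at ha hb
  simp [cupCapDiagram, ha, ← hab, hb]

theorem cupCapDiagram_partner_of_eq (hij : i = a ∧ j = b ∨ i = b ∧ j = a) :
    (cupCapDiagram n a (hab ▸ b.isLt)).partner (Sum.inl i) = Sum.inl j ∧
      (cupCapDiagram n a (hab ▸ b.isLt)).partner (Sum.inr i) = Sum.inr j := by
  have hba : b.val ≠ a.val := by omega
  rcases hij with ⟨rfl, rfl⟩ | ⟨rfl, rfl⟩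
  · simp [cupCapDiagram, ← hab]
  · simp [cupCapDiagram, ← hab, hba]

theorem concatTrace_cupCapDiagram_of_partner_ne (ha : d.partner v ≠ Sum.inl a)
    (hb : d.partner v ≠ Sum.inl b) :
    ConcatTrace (cupCapDiagram n a (hab ▸ b.isLt)) d (d.partner v) (Sum.inr v) (d.word v) := by
  rcases hv : d.partner v with j | j
  · rw [← (d.word v).append_nil]
    exact .arrive_top hv (cupCapDiagram_partner_of_ne hab (by grind) (by grind)).2
  · exact .arrive_bottom hv

theorem concatTrace_cupCapDiagram (hd : d.partner (Sum.inl a) ≠ Sum.inl b)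
    (ha : v ≠ Sum.inl a) (hb : v ≠ Sum.inl b) :
    ConcatTrace (cupCapDiagram n a (hab ▸ b.isLt)) d
      ((d.join (Sum.inl a) (Sum.inl b) (inl_ne_inl_of_val_eq_succ hab)).partner v) (Sum.inr v)
      ((d.join (Sum.inl a) (Sum.inl b) (inl_ne_inl_of_val_eq_succ hab)).word v) := by
  by_cases hv : ∃ i j, d.partner v = Sum.inl i ∧ (i = a ∧ j = b ∨ i = b ∧ j = a)
  · obtain ⟨i, j, hvi, hij⟩ := hv
    have := d.partner_partner
    have := d.partner_ne
    obtain ⟨hp, hw⟩ := d.join_of_partner_eq (inl_ne_inl_of_val_eq_succ hab) (x := Sum.inl j)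
      ha hb (by grind)
    rw [hp, hw]
    exact .turn hvi (cupCapDiagram_partner_of_eq hab hij).2
      (concatTrace_cupCapDiagram_of_partner_ne hab (by grind) (by grind))
  · have hva : d.partner v ≠ Sum.inl a := fun h => hv ⟨a, b, h, by simp⟩
    have hvb : d.partner v ≠ Sum.inl b := fun h => hv ⟨b, a, h, by simp⟩
    obtain ⟨hp, hw⟩ := d.join_of_partner_ne (inl_ne_inl_of_val_eq_succ hab) ha hb hva hvb
    rw [hp, hw]
    exact concatTrace_cupCapDiagram_of_partner_ne hab hva hvb

theorem gluesTo_cupCapDiagram (hd : d.partner (Sum.inl a) ≠ Sum.inl b) :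
    GluesTo (cupCapDiagram n a (hab ▸ b.isLt)) d
      (d.join (Sum.inl a) (Sum.inl b) (inl_ne_inl_of_val_eq_succ hab)) := by
  refine ⟨?_, exists_concatTrace_of_lower fun v => ?_⟩
  · rintro (i | i)
    · by_cases hi : ∃ j, i = a ∧ j = b ∨ i = b ∧ j = a
      · obtain ⟨j, hij⟩ := hi
        have hp : (d.join (Sum.inl a) (Sum.inl b) (inl_ne_inl_of_val_eq_succ hab)).partner
            (Sum.inl i) = Sum.inl j ∧ (d.join (Sum.inl a) (Sum.inl b)
              (inl_ne_inl_of_val_eq_succ hab)).word (Sum.inl i) = [] := by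
          simp only [Decorated.join]
          grind
        rw [hp.1, hp.2]
        exact .start_top (cupCapDiagram_partner_of_eq hab hij).1
      · have hia : i ≠ a := fun h => hi ⟨b, by simp [h]⟩
        have hib : i ≠ b := fun h => hi ⟨a, by simp [h]⟩
        exact .start_propagating (cupCapDiagram_partner_of_ne hab hia hib).1
          (concatTrace_cupCapDiagram hab hd (by simpa) (by simpa))
    · exact concatTrace_cupCapDiagram hab hd (by simp) (by simp)
  · by_cases hv : v = Sum.inl a ∨ v = Sum.inl b
    · have := d.partner_partner
      have := d.partner_ne
      exact ⟨_, _, concatTrace_cupCapDiagram_of_partner_ne hab (by grind) (by grind)⟩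
    · rw [not_or] at hv
      exact ⟨_, _, concatTrace_cupCapDiagram hab hd hv.1 hv.2⟩

end CupCap

/-- Replace the word on the line at `v` by `w`, read from `v`. -/
def Decorated.setWord {V : Type} [DecidableEq V] (d : Decorated V) (v : V) (w : List Blob) :
    Decorated V where
  partner := d.partner
  word x := if x = v then w else if x = d.partner v then w.reverse else d.word x
  partner_partner := d.partner_partner
  partner_ne := d.partner_ne
  word_partner x := by
    have := d.partner_partner
    have := d.partner_ne
    have := d.word_partner
    grind [List.reverse_reverse]

theorem Decorated.setWord_setWord {V : Type} [DecidableEq V] (d : Decorated V) (v : V)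
    (w w' : List Blob) : (d.setWord v w).setWord v w' = d.setWord v w' := by
  ext1
  · rfl
  · funext x
    simp only [setWord]
    split_ifs <;> rfl

theorem Decorated.setWord_word_self {V : Type} [DecidableEq V] (d : Decorated V) (v : V) :
    d.setWord v (d.word v) = d := by
  ext1
  · rfl
  · funext x
    simp only [setWord]
    split_ifs with hx hpx
    · rw [hx]
    · rw [hpx, d.word_partner]
    · rfl

theorem concatTrace_eDiagram {z : Fin n} (hz : z.val = 0) (v : Vertex n) :
    ConcatTrace (eDiagram n) d (d.partner v) (Sum.inr v)
      (d.word v ++ if d.partner v = Sum.inl z then [Blob.L] else []) := by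
  rcases hv : d.partner v with j | j
  · have hword : (eDiagram n).word (Sum.inr j) =
        if (Sum.inl j : Vertex n) = Sum.inl z then [Blob.L] else [] := by
      simp [eDiagram, verticalDiagram, Fin.ext_iff, hz]
    rw [← hword]
    exact .arrive_top hv rfl
  · rw [if_neg Sum.inr_ne_inl, List.append_nil]
    exact .arrive_bottom hv

theorem gluesTo_eDiagram {z : Fin n} (hz : z.val = 0) :
    GluesTo (eDiagram n) d (d.setWord (Sum.inl z) (Blob.L :: d.word (Sum.inl z))) := by
  have hlower := concatTrace_eDiagram (d := d) hz
  refine ⟨?_, exists_concatTrace_of_lower fun v => ⟨_, _, hlower v⟩⟩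
  rintro (i | i)
  · have hword : (d.setWord (Sum.inl z) (Blob.L :: d.word (Sum.inl z))).word (Sum.inl i) =
        (eDiagram n).word (Sum.inl i) ++ (d.word (Sum.inl i) ++
          if d.partner (Sum.inl i) = Sum.inl z then [Blob.L] else []) := by
      simp only [eDiagram, verticalDiagram, Decorated.setWord, Sum.elim_inl, ← hz, ← Fin.ext_iff]
      have := d.partner_partner
      have := d.partner_ne
      have := d.word_partner
      grind
    rw [hword]
    exact .start_propagating rfl (hlower (Sum.inl i))
  · have hword : (d.setWord (Sum.inl z) (Blob.L :: d.word (Sum.inl z))).word (Sum.inr i) =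
        d.word (Sum.inr i) ++ if d.partner (Sum.inr i) = Sum.inl z then [Blob.L] else [] := by
      simp only [Decorated.setWord]
      have := d.partner_partner
      have := d.word_partner
      grind
    rw [hword]
    exact hlower (Sum.inr i)

end Products

section Slide

variable {V : Type} [DecidableEq V] {a b x v : V}

/-- The permutation of the vertices that moves the vertex `x` to `a` and the vertices `a`, `b` one
step towards `x`. -/
def slidePerm (a b x : V) : Equiv.Perm V := Equiv.swap a b * Equiv.swap b x

theorem slidePerm_left (hab : a ≠ b) (hxa : x ≠ a) : slidePerm a b x a = b := by
  simp [slidePerm, Equiv.swap_apply_of_ne_of_ne hab hxa.symm]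

theorem slidePerm_middle (hxa : x ≠ a) (hxb : x ≠ b) : slidePerm a b x b = x := by
  simp [slidePerm, Equiv.swap_apply_of_ne_of_ne hxa hxb]

theorem slidePerm_right : slidePerm a b x x = a := by
  simp [slidePerm]

theorem slidePerm_of_ne (ha : v ≠ a) (hb : v ≠ b) (hx : v ≠ x) : slidePerm a b x v = v := by
  simp [slidePerm, Equiv.swap_apply_of_ne_of_ne hb hx, Equiv.swap_apply_of_ne_of_ne ha hb]

/-- If `{a, b}` is a line, then it is replaced by the line `{b, x}`, and the line that ends at `x`
is made to end at `a` instead. -/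
def Decorated.slide (d : Decorated V) (a b x : V) : Decorated V := d.relabel (slidePerm a b x) id

theorem Decorated.slide_partner (d : Decorated V) (a b x v : V) :
    (d.slide a b x).partner (slidePerm a b x v) = slidePerm a b x (d.partner v) :=
  d.relabel_partner _ _ v

theorem Decorated.slide_word (d : Decorated V) (a b x v : V) :
    (d.slide a b x).word (slidePerm a b x v) = d.word v :=
  (d.relabel_word _ _ v).trans (List.map_id _)

variable {d : Decorated V}

theorem Decorated.slide_middle (hab : a ≠ b) (hxa : x ≠ a) (hxb : x ≠ b) (hd : d.partner a = b) :
    (d.slide a b x).partner b = x ∧ (d.slide a b x).word b = d.word a := by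
  have hp := d.slide_partner a b x a
  have hw := d.slide_word a b x a
  rw [slidePerm_left hab hxa] at hp hw
  exact ⟨by rw [hp, hd, slidePerm_middle hxa hxb], hw⟩

theorem Decorated.slide_left (hxa : x ≠ a) (hxb : x ≠ b) (hd : d.partner a = b) :
    (d.slide a b x).partner a = d.partner x ∧ (d.slide a b x).word a = d.word x := by
  have hp := d.slide_partner a b x x
  have hw := d.slide_word a b x x
  rw [slidePerm_right] at hp hw
  have := d.partner_partner
  exact ⟨by rw [hp, slidePerm_of_ne (by grind) (by grind) (d.partner_ne x)], hw⟩

theorem Decorated.slide_of_ne (hd : d.partner a = b) (ha : v ≠ a) (hb : v ≠ b) (hx : v ≠ x)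
    (hpx : d.partner v ≠ x) :
    (d.slide a b x).partner v = d.partner v ∧ (d.slide a b x).word v = d.word v := by
  have hp := d.slide_partner a b x v
  have hw := d.slide_word a b x v
  rw [slidePerm_of_ne ha hb hx] at hp hw
  have := d.partner_partner
  exact ⟨by rw [hp, slidePerm_of_ne (by grind) (by grind) (by grind)], hw⟩

theorem Decorated.join_slide (hab : a ≠ b) (hxa : x ≠ a) (hxb : x ≠ b) (hd : d.partner a = b)
    (hwa : d.word a = []) : (d.slide a b x).join a b hab = d := by
  have hm := slide_middle hab hxa hxb hd
  have hl := slide_left hxa hxb hd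
  have hv v := @slide_of_ne V _ a b x v d hd
  have := d.partner_partner
  have := d.word_partner
  have := (d.slide a b x).word_partner
  ext1 <;> funext v <;> simp only [join] <;> grind

end Slide

section SlideDiagram

variable {n : ℕ} {d : Diagram n} {a b u v x : Vertex n}

theorem pos_slidePerm (hab : a ≠ b) (hxa : x ≠ a) (hxb : x ≠ b) (v : Vertex n) :
    pos (slidePerm a b x v) = if pos v = pos a then pos b else if pos v = pos b then pos x
      else if pos v = pos x then pos a else pos v := by
  simp only [pos_injective.eq_iff]
  split_ifs with ha hb hx
  · rw [ha, slidePerm_left hab hxa]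
  · rw [hb, slidePerm_middle hxa hxb]
  · rw [hx, slidePerm_right]
  · rw [slidePerm_of_ne ha hb hx]

theorem Diagram.pos_partner_cases (hp : d.partner a = b) (v : Vertex n) :
    pos v = pos a ∧ pos (d.partner v) = pos b ∨ pos v = pos b ∧ pos (d.partner v) = pos a ∨
      (pos v ≠ pos a ∧ pos v ≠ pos b) ∧
        pos (d.partner v) ≠ pos a ∧ pos (d.partner v) ≠ pos b := by
  simp only [ne_eq, pos_injective.eq_iff]
  have := d.partner_partner
  grind

theorem Diagram.Noncrossing.slide (hd : d.Noncrossing) (hp : d.partner a = b)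
    (hab : pos b = pos a + 1) (hbx : pos b < pos x)
    (hin : ∀ v, pos b < pos v → pos v < pos x →
      pos b < pos (d.partner v) ∧ pos (d.partner v) < pos x) :
    Diagram.Noncrossing (d.slide a b x) := by
  have hab' : a ≠ b := fun h => by rw [h] at hab; omega
  have hxa : x ≠ a := fun h => by rw [h] at hbx; omega
  have hxb : x ≠ b := fun h => by rw [h] at hbx; omega
  rw [noncrossing_iff] at *
  refine (slidePerm a b x).forall_congr_right.1 fun u =>
    (slidePerm a b x).forall_congr_right.1 fun v => ?_
  simp only [Decorated.slide_partner, pos_slidePerm hab' hxa hxb]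
  have huv := hd u v
  have hvu := hd v u
  have hu := hin u
  have hv := hin v
  have hpu := hin (d.partner u)
  have hpv := hin (d.partner v)
  rw [d.partner_partner] at hpu hpv
  rcases d.pos_partner_cases hp u with hu' | hu' | hu' <;>
    rcases d.pos_partner_cases hp v with hv' | hv' | hv' <;>
    simp only [hu', hv', if_true, if_false] <;> split_ifs <;> omega

theorem pos_lt_iff_isLeft : pos v < n ↔ v.isLeft := by
  rcases v with i | i <;> simp only [pos, Sum.isLeft_inl, Sum.isLeft_inr] <;> grind

theorem Diagram.simultaneous_iff : d.Simultaneous ↔ ∀ u v,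
    (d.word u).head? = some Blob.L → (d.word v).head? = some Blob.R →
      (pos u < n → pos v < n → pos u < pos v) ∧ (n ≤ pos u → n ≤ pos v → pos v < pos u) := by
  simp only [Sum.forall, pos, Diagram.Simultaneous, Fin.lt_def]
  constructor
  · intro h
    grind
  · intro h
    grind

theorem Diagram.exists_topBottomLR_iff : (∃ i j, d.TopBottomLR i j) ↔
    (∃ u, d.word u = [Blob.L, Blob.R] ∧ pos u < n ∧ pos (d.partner u) < n) ∧
      ∃ v, d.word v = [Blob.L, Blob.R] ∧ ¬ pos v < n ∧ ¬ pos (d.partner v) < n := by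
  simp only [pos_lt_iff_isLeft]
  constructor
  · rintro ⟨i, j, hi, hpi, hj, hpj⟩
    exact ⟨⟨Sum.inl i, hi, rfl, hpi⟩, Sum.inr j, hj, by simp, by simpa using hpj⟩
  · rintro ⟨⟨i | i, hi, hi', hpi⟩, j | j, hj, hj', hpj⟩
    · exact absurd rfl hj'
    · exact ⟨i, j, hi, hpi, hj, by simpa using hpj⟩
    · exact absurd rfl hj'
    · exact absurd hi' (by simp)

section Neighbour

variable (hp : d.partner a = b) (hw : d.word a = []) (hab : pos b = pos a + 1)
  (hbx : pos x = pos b + 1)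

include hab hbx in
theorem pos_slidePerm_of_succ (v : Vertex n) : pos (slidePerm a b x v) =
    if pos v = pos a then pos b else if pos v = pos b then pos x
      else if pos v = pos x then pos a else pos v :=
  pos_slidePerm (by grind) (by grind) (by grind) v

include hp hw in
theorem Diagram.pos_ne_of_word_ne_nil (hv : d.word v ≠ []) : pos v ≠ pos a ∧ pos v ≠ pos b := by
  simp only [pos_injective.ne_iff]
  have := d.word_partner a
  grind

include hp hw hab hbx in
theorem Diagram.pos_slidePerm_lt_iff (hu : d.word u ≠ []) (hv : d.word v ≠ []) :
    pos (slidePerm a b x u) < pos (slidePerm a b x v) ↔ pos u < pos v := by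
  have := pos_ne_of_word_ne_nil hp hw hu
  have := pos_ne_of_word_ne_nil hp hw hv
  simp only [pos_slidePerm_of_succ hab hbx]
  split_ifs <;> omega

include hp hw hab hbx in
theorem Diagram.LExposed.slide (hv : d.LExposed v) (hwv : d.word v ≠ []) :
    Diagram.LExposed (d.slide a b x) (slidePerm a b x v) := by
  refine (slidePerm a b x).forall_congr_right.1 fun u => ?_
  have hu := hv u
  obtain ⟨hva, hvb⟩ := pos_ne_of_word_ne_nil hp hw hwv
  simp only [Inside, Decorated.slide_partner, pos_slidePerm_of_succ hab hbx] at *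
  rcases d.pos_partner_cases hp u with hu' | hu' | hu' <;>
    simp only [hu', hva, hvb, if_true, if_false] at hu ⊢ <;> split_ifs <;> omega

variable (hxn : pos x < n)

include hab hbx hxn in
theorem pos_slidePerm_lt (v : Vertex n) : pos (slidePerm a b x v) < n ↔ pos v < n := by
  rw [pos_slidePerm_of_succ hab hbx]
  split_ifs <;> omega

include hp hw hab hbx hxn in
theorem Diagram.RExposed.slide (hv : d.RExposed v) (hwv : d.word v ≠ []) :
    Diagram.RExposed (d.slide a b x) (slidePerm a b x v) := by
  refine (slidePerm a b x).forall_congr_right.1 fun u => ?_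
  have hu := hv u
  obtain ⟨hva, hvb⟩ := pos_ne_of_word_ne_nil hp hw hwv
  simp only [Inside, Decorated.slide_partner, pos_slidePerm_of_succ hab hbx,
    EmbeddingLike.apply_eq_iff_eq, ne_eq] at *
  rw [← pos_injective.eq_iff, ← pos_injective.eq_iff (a := d.partner u)] at hu ⊢
  rcases d.pos_partner_cases hp u with hu' | hu' | hu' <;>
    simp only [hu', hva, hvb, if_true, if_false] at hu ⊢ <;> split_ifs <;> omega

include hp hw hab hbx hxn in
theorem IsBasisDiagram.slide (hd : IsBasisDiagram d) : IsBasisDiagram (d.slide a b x) := by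
  obtain ⟨hd, hLR⟩ := hd
  refine ⟨⟨?_, ?_, ?_, ?_, ?_⟩, ?_⟩
  · exact hd.noncrossing.slide hp hab (by omega) fun v _ _ => by omega
  · refine (slidePerm a b x).forall_congr_right.1 fun v hv => ?_
    rw [Decorated.slide_word] at hv
    exact (hd.left_exposed v hv).slide hp hw hab hbx (List.ne_nil_of_mem hv)
  · refine (slidePerm a b x).forall_congr_right.1 fun v hv => ?_
    rw [Decorated.slide_word] at hv
    exact (hd.right_exposed v hv).slide hp hw hab hbx hxn (List.ne_nil_of_mem hv)
  · rw [Diagram.simultaneous_iff]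
    refine (slidePerm a b x).forall_congr_right.1 fun u =>
      (slidePerm a b x).forall_congr_right.1 fun v hu hv => ?_
    rw [Decorated.slide_word] at hu hv
    have huv := Diagram.pos_slidePerm_lt_iff hp hw hab hbx (u := u) (v := v) (by grind) (by grind)
    have hvu := Diagram.pos_slidePerm_lt_iff hp hw hab hbx (u := v) (v := u) (by grind) (by grind)
    simp only [← not_lt, pos_slidePerm_lt hab hbx hxn, huv, hvu]
    simpa only [← not_lt] using Diagram.simultaneous_iff.1 hd.simultaneous u v hu hv
  · refine (slidePerm a b x).forall_congr_right.1 fun v => ?_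
    rw [Decorated.slide_word]
    exact hd.featureFree v
  · simp only [← not_exists] at hLR ⊢
    rw [Diagram.exists_topBottomLR_iff] at hLR ⊢
    rintro ⟨⟨u, hu⟩, v, hv⟩
    obtain ⟨u, rfl⟩ := (slidePerm a b x).surjective u
    obtain ⟨v, rfl⟩ := (slidePerm a b x).surjective v
    simp only [Decorated.slide_word, Decorated.slide_partner,
      pos_slidePerm_lt hab hbx hxn] at hu hv
    exact hLR ⟨⟨u, hu⟩, v, hv⟩

end Neighbour

end SlideDiagram

section Cup

variable {n : ℕ} {d : Diagram n} {a b c : Fin n} {x : Vertex n}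

/-- The neighbours `a` and `b` on the top edge are joined by an undecorated line. -/
structure Diagram.HasCup (d : Diagram n) (a b : Fin n) : Prop where
  val_eq : b.val = a.val + 1
  partner_eq : d.partner (Sum.inl a) = Sum.inl b
  word_eq : d.word (Sum.inl a) = []

theorem Generated.of_slide (hs : Generated (d.slide (Sum.inl a) (Sum.inl b) x))
    (hd : IsBasisDiagram d) (h : d.HasCup a b) (hxa : x ≠ Sum.inl a) (hxb : x ≠ Sum.inl b) :
    Generated d := by
  have hab := inl_ne_inl_of_val_eq_succ h.val_eq
  have hglue := gluesTo_cupCapDiagram h.val_eq (d := d.slide (Sum.inl a) (Sum.inl b) x) <| by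
    intro hpa
    have hpb := (Decorated.slide_middle hab hxa hxb h.partner_eq).1
    have hpa' := congrArg (d.slide (Sum.inl a) (Sum.inl b) x).partner hpa
    rw [Decorated.partner_partner, hpb] at hpa'
    exact hxa hpa'.symm
  rw [Decorated.join_slide hab hxa hxb h.partner_eq h.word_eq] at hglue
  exact hs.mul_left (Or.inr (Or.inr ⟨a, _, rfl⟩)) hd hglue

theorem Diagram.HasCup.slide (h : d.HasCup a b) (hbc : c.val = b.val + 1) :
    Diagram.HasCup (d.slide (Sum.inl a) (Sum.inl b) (Sum.inl c)) b c := by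
  have hab := h.val_eq
  have := Decorated.slide_middle (inl_ne_inl_of_val_eq_succ h.val_eq) (x := Sum.inl c)
    (Sum.inl_injective.ne (Fin.ne_of_val_ne (by omega)))
    (Sum.inl_injective.ne (Fin.ne_of_val_ne (by omega))) h.partner_eq
  exact ⟨hbc, this.1, this.2.trans h.word_eq⟩

theorem Diagram.HasCup.isBasisDiagram_slide (h : d.HasCup a b) (hbc : c.val = b.val + 1)
    (hd : IsBasisDiagram d) : IsBasisDiagram (d.slide (Sum.inl a) (Sum.inl b) (Sum.inl c)) :=
  hd.slide h.partner_eq h.word_eq h.val_eq hbc c.isLt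

end Cup

section InnermostCup

variable {n : ℕ} {d : Diagram n} {a b : Fin n} {u v : Vertex n}

theorem Diagram.IsLeftRightBlob.word_eq_nil_of_inside (hd : d.IsLeftRightBlob) (h : d.Inside u v)
    (hu : pos (d.partner u) < n) : d.word v = [] := by
  have hL := fun hv => hd.left_exposed v hv u h
  have hR := fun hv => hd.right_exposed v hv u (h.1.trans h.2) (by rintro rfl; exact h.1.false)
    (by rintro rfl; exact h.2.false)
  refine List.eq_nil_iff_forall_not_mem.2 fun x hx => ?_
  cases x with
  | L => exact hL hx
  | R => exact absurd ((hR hx).1 h).2 hu.not_ge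

theorem Diagram.IsLeftRightBlob.exists_hasCup (hd : d.IsLeftRightBlob)
    (hp : d.partner (Sum.inl a) = Sum.inl b) (hw : d.word (Sum.inl a) = []) (hab : a < b) :
    ∃ i j, d.HasCup i j ∧ j ≤ b := by
  induction hm : b.val - a.val using Nat.strong_induction_on generalizing a b with
  | _ m ih =>
    rw [Fin.lt_def] at hab
    rcases (Nat.succ_le_of_lt hab).eq_or_lt with hba | hab'
    · exact ⟨a, b, ⟨hba.symm, hp, hw⟩, le_rfl⟩
    · let c : Fin n := ⟨a.val + 1, by omega⟩
      have hac : d.Inside (Sum.inl a) (Sum.inl c) := by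
        rw [Inside, hp]
        exact ⟨Nat.lt_succ_self _, hab'⟩
      have hae := hd.noncrossing _ _ hac
      have hwc := hd.word_eq_nil_of_inside hac (by rw [hp]; exact b.isLt)
      rw [Inside, hp] at hae
      rcases hpc : d.partner (Sum.inl c) with e | e <;> rw [hpc] at hae <;>
        simp only [pos] at hae
      · have hce : e ≠ c := fun h => d.partner_ne (Sum.inl c) (by rw [hpc, h])
        have hce' : c.val < e.val := by
          have := Fin.val_ne_of_ne hce
          simp only [c] at this ⊢
          omega
        obtain ⟨i, j, hij, hje⟩ := ih _ (by simp only [c]; omega) hpc hwc hce' rfl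
        exact ⟨i, j, hij, hje.trans (Fin.le_def.2 hae.2.le)⟩
      · omega

theorem Generated.of_hasCup {K : Diagram n → Prop} {t : Fin n}
    (slide : ∀ {d a b c}, K d → d.HasCup a b → c.val = b.val + 1 → c ≤ t →
      K (d.slide (Sum.inl a) (Sum.inl b) (Sum.inl c)))
    (last : ∀ {d a}, IsBasisDiagram d → K d → d.HasCup a t → Generated d)
    (hd : IsBasisDiagram d) (hK : K d) (h : d.HasCup a b) (hbt : b ≤ t) : Generated d := by
  induction hm : t.val - b.val generalizing d a b with
  | zero =>
    obtain rfl : b = t := by rw [Fin.le_def] at hbt; omega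
    exact last hd hK h
  | succ m ih =>
    let c : Fin n := ⟨b.val + 1, by omega⟩
    have hc : c ≤ t := by simp only [Fin.le_def, c]; omega
    have hs := ih (h.isBasisDiagram_slide (c := c) rfl hd) (slide hK h rfl hc) (h.slide rfl) hc
      (by simp only [c]; omega)
    have := h.val_eq
    exact hs.of_slide hd h (Sum.inl_injective.ne (Fin.ne_of_val_ne (by simp only [c]; omega)))
      (Sum.inl_injective.ne (Fin.ne_of_val_ne (by simp only [c]; omega)))

end InnermostCup

section Undecorated

variable {n : ℕ} {d : Diagram n}

theorem Diagram.Noncrossing.isBasisDiagram (hd : d.Noncrossing) (hw : ∀ v, d.word v = []) :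
    IsBasisDiagram d := by
  refine ⟨⟨hd, ?_, ?_, ⟨?_, ?_⟩, fun v => featureFree_of_length_le_one _ ?_⟩, ?_⟩ <;>
    simp [hw, Diagram.TopBottomLR]

theorem Diagram.Noncrossing.eq_identityDiagram (hd : d.Noncrossing) (hw : ∀ v, d.word v = [])
    (hp : ∀ i, (d.partner (Sum.inl i)).isRight) : d = identityDiagram n := by
  choose g hg using fun i => Sum.isRight_iff.1 (hp i)
  have hmono : StrictMono g := by
    intro i j hij
    have h := hd (Sum.inl i) (Sum.inl j) ⟨hij, by rw [hg]; simp only [pos]; omega⟩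
    rw [Diagram.Inside, hg, hg] at h
    simp only [pos] at h
    rw [Fin.lt_def]
    omega
  have hid : g = id := by
    rw [← hmono.range_inj strictMono_id,
      (Finite.surjective_of_injective hmono.injective).range_eq, Set.range_id]
  have hgi : ∀ i, d.partner (Sum.inl i) = Sum.inr i := by simpa [hid] using hg
  ext1 <;> funext v
  · rcases v with i | i
    · exact hgi i
    · exact (congrArg d.partner (hgi i)).symm.trans (d.partner_partner _)
  · rcases v with i | i <;> simp [hw, identityDiagram, verticalDiagram]

theorem IsBasisDiagram.exists_hasCup_of_undecorated (hd : IsBasisDiagram d)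
    (hw : ∀ v, d.word v = []) {i : Fin n} (hi : (d.partner (Sum.inl i)).isLeft) :
    ∃ a b, d.HasCup a b ∧ ∃ c, b ≤ c ∧ (d.partner (Sum.inl c)).isLeft := by
  obtain ⟨j, hj⟩ := Sum.isLeft_iff.1 hi
  have hji := d.partner_partner (Sum.inl i)
  rw [hj] at hji
  have hne : i ≠ j := by
    rintro rfl
    exact d.partner_ne _ hj
  rcases hne.lt_or_gt with h | h
  · obtain ⟨a, b, hab, hb⟩ := hd.1.exists_hasCup hj (hw _) h
    exact ⟨a, b, hab, j, hb, by simp [hji]⟩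
  · obtain ⟨a, b, hab, hb⟩ := hd.1.exists_hasCup hji (hw _) h
    exact ⟨a, b, hab, i, hb, hi⟩

/-- The line with upper endpoint `M` is made vertical by a slide across the line at the bottom
vertex `M`. -/
theorem Diagram.HasCup.noncrossing_slide_inr {a M : Fin n} (h : d.HasCup a M)
    (hd : d.Noncrossing) (hv : ∀ j, M < j → d.partner (Sum.inl j) = Sum.inr j) :
    Diagram.Noncrossing (d.slide (Sum.inl a) (Sum.inl M) (Sum.inr M)) := by
  refine hd.slide h.partner_eq h.val_eq (by simp only [pos]; omega) ?_
  rintro (j | j) hMj hjM <;> simp only [pos] at hMj hjM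
  · rw [hv j hMj]
    simp only [pos]
    omega
  · have hj := hv j (by rw [Fin.lt_def]; omega)
    rw [← hj, d.partner_partner]
    simp only [pos]
    omega

theorem Decorated.slide_word_eq_nil {V : Type} [DecidableEq V] {d : Decorated V}
    (hw : ∀ v, d.word v = []) (a b x : V) : ∀ v, (d.slide a b x).word v = [] :=
  (slidePerm a b x).forall_congr_right.1 fun v => by rw [slide_word, hw]

theorem Generated.of_hasCup_of_undecorated {a b M : Fin n}
    (ih : ∀ {d : Diagram n}, d.Noncrossing → (∀ v, d.word v = []) →
      (∀ j, M ≤ j → d.partner (Sum.inl j) = Sum.inr j) → Generated d)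
    (hd : IsBasisDiagram d) (hw : ∀ v, d.word v = [])
    (hv : ∀ j, M < j → d.partner (Sum.inl j) = Sum.inr j) (h : d.HasCup a b) (hb : b ≤ M) :
    Generated d := by
  refine Generated.of_hasCup (K := fun d : Diagram n => (∀ v, d.word v = []) ∧
    ∀ j, M < j → d.partner (Sum.inl j) = Sum.inr j) ?_ ?_ hd ⟨hw, hv⟩ h hb
  · rintro d a b c ⟨hw, hv⟩ h hbc hcM
    refine ⟨d.slide_word_eq_nil hw _ _ _, fun j hj => ?_⟩
    have hab := h.val_eq
    rw [Fin.le_def] at hcM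
    rw [Fin.lt_def] at hj
    rw [(Decorated.slide_of_ne h.partner_eq _ _ _ _).1, hv j hj] <;>
      simp only [hv j hj, ne_eq, Sum.inl.injEq, reduceCtorEq, not_false_eq_true,
        Fin.ext_iff] <;> omega
  · rintro d a hd ⟨hw, hv⟩ h
    refine .of_slide (x := Sum.inr M) (ih (h.noncrossing_slide_inr hd.1.noncrossing hv)
      (d.slide_word_eq_nil hw _ _ _) fun j hj => ?_) hd h Sum.inr_ne_inl Sum.inr_ne_inl
    rcases hj.eq_or_lt with rfl | hj
    · exact (Decorated.slide_middle (inl_ne_inl_of_val_eq_succ h.val_eq) Sum.inr_ne_inl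
        Sum.inr_ne_inl h.partner_eq).1
    · have hab := h.val_eq
      rw [Fin.lt_def] at hj
      rw [(Decorated.slide_of_ne h.partner_eq _ _ _ _).1, hv j hj] <;>
        simp only [hv j hj, ne_eq, Sum.inl.injEq, Sum.inr.injEq, reduceCtorEq, not_false_eq_true,
          Fin.ext_iff] <;> omega

theorem Diagram.Noncrossing.generated (hd : d.Noncrossing) (hw : ∀ v, d.word v = []) :
    Generated d := by
  suffices h : ∀ N : ℕ, ∀ {d : Diagram n}, d.Noncrossing → (∀ v, d.word v = []) →
      (∀ j : Fin n, N ≤ j.val → d.partner (Sum.inl j) = Sum.inr j) → Generated d from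
    h n hd hw fun j hj => absurd j.isLt hj.not_gt
  intro N
  induction N with
  | zero => exact fun hd hw hv => hd.eq_identityDiagram hw (by simp [hv]) ▸ .one
  | succ M ih =>
    intro d hd hw hv
    by_cases hall : ∀ i, (d.partner (Sum.inl i)).isRight
    · exact hd.eq_identityDiagram hw hall ▸ .one
    push Not at hall
    obtain ⟨i, hi⟩ := hall
    obtain ⟨a, b, h, c, hbc, hc⟩ :=
      (hd.isBasisDiagram hw).exists_hasCup_of_undecorated hw (by simpa using hi)
    have hcM : c.val ≤ M := by
      by_contra hcM
      simp [hv c (by omega)] at hc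
    rcases le_or_gt n M with hn | hM
    · exact ih hd hw fun j hj => by omega
    · exact .of_hasCup_of_undecorated (M := ⟨M, hM⟩) ih (hd.isBasisDiagram hw) hw hv h
        (hbc.trans hcM)

end Undecorated

section BlobRemoval

variable {n : ℕ} {d : Diagram n} {z : Fin n} {w : List Blob} {x : Blob}

theorem FeatureFree.of_isInfix {w' : List Blob} (hw : FeatureFree w) (h : w' <:+: w) :
    FeatureFree w' :=
  fun x y => ⟨fun hx => (hw x y).1 (hx.trans h), fun hx => (hw x y).2 (hx.trans h)⟩

theorem FeatureFree.tail_eq (h : FeatureFree (Blob.L :: w)) : w = [] ∨ w = [Blob.R] := by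
  simpa using h.eq

section

variable {V : Type} [DecidableEq V] {d : Decorated V} {v : V}

theorem Decorated.setWord_word_left (w : List Blob) : (d.setWord v w).word v = w :=
  if_pos rfl

theorem Decorated.setWord_tail_cases (hw : d.word v = x :: w) (u : V) (hu : u ≠ v) :
    (d.setWord v w).word u = d.word u ∨
      (d.setWord v w).word u = w.reverse ∧ d.word u = w.reverse ++ [x] := by
  simp only [setWord, if_neg hu]
  split_ifs with hpu
  · exact Or.inr ⟨rfl, by rw [hpu, d.word_partner, hw, List.reverse_cons]⟩
  · exact Or.inl rfl

theorem Decorated.setWord_tail_isInfix (hw : d.word v = x :: w) (u : V) :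
    (d.setWord v w).word u <:+: d.word u := by
  rcases eq_or_ne u v with rfl | hu
  · rw [setWord_word_left, hw]
    exact (List.suffix_cons x w).isInfix
  · rcases setWord_tail_cases hw u hu with h | ⟨h, h'⟩
    · rw [h]
    · rw [h, h']
      exact (List.prefix_append _ _).isInfix

theorem Decorated.head?_setWord_tail (hw : d.word v = x :: w) {u : V} (hu : u ≠ v) {y : Blob}
    (h : ((d.setWord v w).word u).head? = some y) : (d.word u).head? = some y := by
  rcases setWord_tail_cases hw u hu with h' | ⟨h', hd⟩
  · rwa [h'] at h
  · rw [h'] at h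
    rw [hd, List.head?_append, h, Option.some_or]

end

theorem Diagram.IsLeftRightBlob.head?_ne_of_word_eq (hd : d.IsLeftRightBlob) (hz : z.val = 0)
    (hw : d.word (Sum.inl z) = [Blob.L, Blob.R]) {i : Fin n} (hi : i ≠ z) :
    (d.word (Sum.inl i)).head? ≠ some Blob.L := by
  intro hiL
  have hzi : z.val < i.val := by
    have := Fin.val_ne_of_ne hi
    omega
  refine hd.left_exposed _ (List.mem_of_head? hiL) (Sum.inl z) ⟨hzi, ?_⟩
  rcases hj : d.partner (Sum.inl z) with j | j
  · refine hd.simultaneous.1 i j hiL ?_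
    rw [← hj, d.word_partner, hw]
    rfl
  · simp only [pos]
    omega

theorem Diagram.IsLeftRightBlob.simultaneous_setWord (hd : d.IsLeftRightBlob) (hz : z.val = 0)
    (hw : d.word (Sum.inl z) = Blob.L :: w) :
    Diagram.Simultaneous (d.setWord (Sum.inl z) w) := by
  have hcases := (hw ▸ hd.featureFree (Sum.inl z)).tail_eq
  refine ⟨fun i j hi hj => ?_, fun i j hi hj => hd.simultaneous.2 i j
    (Decorated.head?_setWord_tail hw Sum.inr_ne_inl hi)
    (Decorated.head?_setWord_tail hw Sum.inr_ne_inl hj)⟩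
  have hiz : i ≠ z := by
    rintro rfl
    rw [Decorated.setWord_word_left] at hi
    rcases hcases with rfl | rfl <;> simp at hi
  have hiL := Decorated.head?_setWord_tail hw (by simpa using hiz) hi
  rcases eq_or_ne j z with rfl | hjz
  · rw [Decorated.setWord_word_left] at hj
    rcases hcases with rfl | rfl
    · simp at hj
    · exact absurd hiL (hd.head?_ne_of_word_eq hz hw hiz)
  · exact hd.simultaneous.1 i j hiL (Decorated.head?_setWord_tail hw (by simpa using hjz) hj)

theorem Decorated.word_eq_of_setWord_tail {V : Type} [DecidableEq V] {d : Decorated V} {u v : V}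
    (hd : FeatureFree (d.word v)) (hw : d.word v = Blob.L :: w)
    (hu : (d.setWord v w).word u = [Blob.L, Blob.R]) : d.word u = [Blob.L, Blob.R] := by
  have hcases := (hw ▸ hd).tail_eq
  rcases eq_or_ne u v with rfl | huv
  · rw [setWord_word_left] at hu
    simp [hu] at hcases
  · rcases setWord_tail_cases hw u huv with h | ⟨h, -⟩
    · rwa [h] at hu
    · rcases hcases with rfl | rfl <;> simp [hu] at h

theorem IsBasisDiagram.setWord_tail (hd : IsBasisDiagram d) (hz : z.val = 0)
    (hw : d.word (Sum.inl z) = Blob.L :: w) : IsBasisDiagram (d.setWord (Sum.inl z) w) := by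
  obtain ⟨hd, hLR⟩ := hd
  have hinfix := Decorated.setWord_tail_isInfix hw
  have hfree := hd.featureFree (Sum.inl z)
  refine ⟨⟨hd.noncrossing, fun v hv => hd.left_exposed v ((hinfix v).subset hv),
    fun v hv => hd.right_exposed v ((hinfix v).subset hv), hd.simultaneous_setWord hz hw,
    fun v => (hd.featureFree v).of_isInfix (hinfix v)⟩, ?_⟩
  rintro i j ⟨hi, hpi, hj, hpj⟩
  exact hLR i j ⟨Decorated.word_eq_of_setWord_tail hfree hw hi, hpi,
    Decorated.word_eq_of_setWord_tail hfree hw hj, hpj⟩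

end BlobRemoval

section BlobCount

variable {n : ℕ} {d : Diagram n} {w : List Blob} {x : Blob}

/-- The number of blobs, each one counted from both ends of its line. -/
def Diagram.blobCount (d : Diagram n) : ℕ := ∑ v, (d.word v).length

theorem Diagram.blobCount_relabel (d : Diagram n) (σ : Vertex n ≃ Vertex n) (β : Blob → Blob) :
    Diagram.blobCount (d.relabel σ β) = d.blobCount := by
  rw [blobCount, ← σ.sum_comp]
  simp [blobCount]

theorem Diagram.blobCount_slide (d : Diagram n) (a b v : Vertex n) :
    Diagram.blobCount (d.slide a b v) = d.blobCount :=
  d.blobCount_relabel _ _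

theorem Diagram.blobCount_setWord_lt {v : Vertex n} (hw : d.word v = x :: w) :
    Diagram.blobCount (d.setWord v w) < d.blobCount := by
  refine Finset.sum_lt_sum (fun u _ => (Decorated.setWord_tail_isInfix hw u).length_le)
    ⟨v, Finset.mem_univ v, ?_⟩
  rw [Decorated.setWord_word_left, hw]
  exact Nat.lt_succ_self _

end BlobCount

section Generation

variable {n : ℕ} {d : Diagram n}

theorem Generated.of_head?_zero (hd : IsBasisDiagram d) {z : Fin n} (hz : z.val = 0)
    (hL : (d.word (Sum.inl z)).head? = some Blob.L)
    (ih : ∀ d' : Diagram n, IsBasisDiagram d' → d'.blobCount < d.blobCount → Generated d') :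
    Generated d := by
  obtain ⟨w, hw⟩ := List.head?_eq_some_iff.1 hL
  have hglue := gluesTo_eDiagram (d := d.setWord (Sum.inl z) w) hz
  rw [Decorated.setWord_word_left, Decorated.setWord_setWord, ← hw,
    Decorated.setWord_word_self] at hglue
  exact (ih _ (hd.setWord_tail hz hw) (Diagram.blobCount_setWord_lt hw)).mul_left (Or.inl rfl) hd
    hglue

theorem IsBasisDiagram.exists_hasCup_of_head? (hd : IsBasisDiagram d) {p t : Fin n}
    (htp : p.val = t.val + 1) (hL : (d.word (Sum.inl p)).head? = some Blob.L)
    (ht : (d.word (Sum.inl t)).head? ≠ some Blob.L) : ∃ a b, d.HasCup a b ∧ b ≤ t := by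
  have hwt : d.word (Sum.inl t) = [] := by
    rw [← List.head?_eq_none_iff, Option.eq_none_iff_forall_ne_some]
    rintro (_ | _) h
    · exact ht h
    · have := hd.1.simultaneous.1 p t hL h
      omega
  obtain ⟨w, hw⟩ := List.head?_eq_some_iff.1 hL
  have hpt : ¬ d.Inside (Sum.inl t) (Sum.inl p) :=
    hd.1.left_exposed _ (List.mem_of_head? hL) _
  have hw' := d.word_partner (Sum.inl t)
  rw [Diagram.Inside] at hpt
  rcases hq : d.partner (Sum.inl t) with q | q <;> rw [hq] at hpt hw' <;> simp only [pos] at hpt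
  · have hqp : q ≠ p := by
      rintro rfl
      simp [hw, hwt] at hw'
    have hqt : q ≠ t := fun h => d.partner_ne (Sum.inl t) (by rw [hq, h])
    have hpq : d.partner (Sum.inl q) = Sum.inl t := by rw [← hq, d.partner_partner]
    refine hd.1.exists_hasCup hpq (by rw [hw', hwt, List.reverse_nil]) ?_
    have := Fin.val_ne_of_ne hqp
    have := Fin.val_ne_of_ne hqt
    rw [Fin.lt_def]
    omega
  · omega

/-- The cup is slid up to `p` and then past `p`, which moves the left blob next to `p` to a vertex
further to the left. -/
theorem Generated.of_head?_inl {p : Fin n} (hd : IsBasisDiagram d)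
    (hL : (d.word (Sum.inl p)).head? = some Blob.L)
    (ih : ∀ d' : Diagram n, IsBasisDiagram d' → d'.blobCount < d.blobCount → Generated d') :
    Generated d := by
  induction hm : p.val using Nat.strong_induction_on generalizing d p with
  | _ m ihp =>
    rcases Nat.eq_zero_or_eq_succ_pred m with hm0 | hmt
    · exact .of_head?_zero hd (hm.trans hm0) hL ih
    let t : Fin n := ⟨m.pred, by omega⟩
    have hpt : p.val = t.val + 1 := hm.trans hmt
    by_cases ht : (d.word (Sum.inl t)).head? = some Blob.L
    · exact ihp t (by omega) hd ht ih rfl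
    obtain ⟨a, b, h, hb⟩ := hd.exists_hasCup_of_head? hpt hL ht
    refine Generated.of_hasCup (K := fun d' : Diagram n => d'.blobCount = d.blobCount ∧
      (d'.word (Sum.inl p)).head? = some Blob.L) ?_ ?_ hd ⟨rfl, hL⟩ h hb
    · rintro d' a b c ⟨hcount, hL⟩ h hbc hct
      have hab := h.val_eq
      rw [Fin.le_def] at hct
      refine ⟨(d'.blobCount_slide _ _ _).trans hcount, ?_⟩
      rwa [← slidePerm_of_ne (a := Sum.inl a) (b := Sum.inl b) (x := Sum.inl c)
        (v := Sum.inl p), Decorated.slide_word] <;>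
        exact Sum.inl_injective.ne (Fin.ne_of_val_ne (by omega))
    · rintro d' a hd' ⟨hcount, hL⟩ h
      have hat := h.val_eq
      have hpa : (Sum.inl p : Vertex n) ≠ Sum.inl a :=
        Sum.inl_injective.ne (Fin.ne_of_val_ne (by omega))
      have hpt' := (inl_ne_inl_of_val_eq_succ hpt).symm
      refine .of_slide (ihp a (by omega) (h.isBasisDiagram_slide hpt hd') ?_ ?_ rfl) hd' h hpa hpt'
      · rwa [(Decorated.slide_left hpa hpt' h.partner_eq).2]
      · rwa [d'.blobCount_slide, hcount]

theorem Generated.of_head? {v : Vertex n} (hd : IsBasisDiagram d)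
    (hL : (d.word v).head? = some Blob.L)
    (ih : ∀ d' : Diagram n, IsBasisDiagram d' → d'.blobCount < d.blobCount → Generated d') :
    Generated d := by
  rcases v with i | i
  · exact .of_head?_inl hd hL ih
  · rw [← d.flip_flip]
    refine (Generated.of_head?_inl (p := i) hd.flip ?_ ?_).flip
    · rwa [← d.flip_word] at hL
    · rwa [Diagram.flip, d.blobCount_relabel]

theorem IsBasisDiagram.generated (hd : IsBasisDiagram d) : Generated d := by
  induction hm : d.blobCount using Nat.strong_induction_on generalizing d with
  | _ m ih =>
    subst hm
    have ih' : ∀ d' : Diagram n, IsBasisDiagram d' → d'.blobCount < d.blobCount → Generated d' :=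
      fun d' hd' hlt => ih _ hlt hd' rfl
    by_cases hw : ∀ v, d.word v = []
    · exact hd.1.noncrossing.generated hw
    push Not at hw
    obtain ⟨v, hv⟩ := hw
    obtain ⟨x, w, hv⟩ := List.exists_cons_of_ne_nil hv
    cases x with
    | L => exact .of_head? hd (by rw [hv, List.head?_cons]) ih'
    | R =>
      rw [← d.mirror_mirror]
      refine (Generated.of_head? hd.mirror (v := mirrorVertex v) ?_ ?_).mirror
      · rw [d.head?_mirror_word, hv]
        rfl
      · rwa [Diagram.mirror, d.blobCount_relabel]

end Generation

end SymplecticBlob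

theorem proposition2p4 {k : Type*} [Field k] (P : SymplecticBlob.Parameters k) (n : ℕ)
    (hn : 1 ≤ n) :
    NonUnitalAlgebra.adjoin k (insert 1 (SymplecticBlob.generators P n)) =
      (⊤ : NonUnitalSubalgebra k (SymplecticBlob.SymplecticBlobAlgebra P n)) := by
  rw [eq_top_iff]
  intro x _
  rw [← (SymplecticBlob.diagramBasis P).linearCombination_repr x,
    Finsupp.linearCombination_apply]
  exact sum_mem fun d _ => SMulMemClass.smul_mem _ (d.2.generated.diagramBasis_mem_adjoin P)
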